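/- Let $k$ be a field, let $B$ be a polynomial ring over $k$ in finitely many variables, graded so that the variables are homogeneous of positive (possibly different) degrees, and let $G$ be a finite group acting faithfully on $B$ by degree-preserving $k$-algebra automorphisms. Let $A=B^G$, let $\mathfrak m_A,\mathfrak m_B$ be the irrelevant maximal ideals of $A$ and $B$, and let $\hat A$, $\hat B$ be the $\mathfrak m_A$-adic completion of $A$ and the $\mathfrak m_B$-adic completion of $B$, with the induced action of $G$ on $\hat B$. Let $B*G$ and $\hat B*G$ be the twisted group algebras, with product $(rg)(r'g')=(r\,(gr'))(gg')$. Assume that the action of $G$ on $B$ is small: there is a $G$-stable open subset $U$ of $X=\operatorname{Spec}B$ on which $G$ acts freely (all inertia groups of points of $U$ are trivial) and such that $X\setminus U$ has codimension at least two in $X$. For a finite-dimensional $kG$-module $V$, regard $B\otimes_kV$ as a $B*G$-module and $\hat B\otimes_kV$ as an $\hat B*G$-module, where $G$ acts diagonally and $B$ (respectively $\hat B$) acts on the left factor; let $M_V=(B\otimes_kV)^G$, an $A$-module, and let the $\hat A$-module $\hat M_V$ be its $\mathfrak m_A$-adic completion. A module is called indecomposable if it is nonzero and is not the direct sum of two nonzero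 submodules. 1. For every finite-dimensional $kG$-module $V$ the following are equivalent: (a) $V$ is an indecomposable $kG$-module; (b) $B\otimes_kV$ is an indecomposable $B*G$-module; (b^) $\hat B\otimes_kV$ is an indecomposable $\hat B*G$-module; (c) $M_V$ is an indecomposable $A$-module; (c^) $\hat M_V$ is an indecomposable $\hat A$-module. 2. For all finite-dimensional $kG$-modules $V,V'$ the following are equivalent: (a) $V\cong V'$ as $kG$-modules; (b) $B\otimes_kV\cong B\otimes_kV'$ as $B*G$-modules; (b^) $\hat B\otimes_kV\cong\hat B\otimes_kV'$ as $\hat B*G$-modules; (c) $M_V\cong M_{V'}$ as $A$-modules; (c^) $\hat M_V\cong\hat M_{V'}$ as $\hat A$-modules. -/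

import Mathlib

open scoped TensorProduct

noncomputable section

/-- A module is indecomposable if it is nonzero and is not the direct sum of two nonzero
submodules. -/
def IsIndecomposableModule (S M : Type*) [Ring S] [AddCommGroup M] [Module S M] : Prop :=
  Nontrivial M ∧ ∀ N N' : Submodule S M, IsCompl N N' → N = ⊥ ∨ N' = ⊥

section Grading

variable {k B : Type*} [Field k] [CommRing B] [Algebra k B] (𝒜 : ℕ → Submodule k B)

/-- The graded `k`-algebra `B = ⨁ 𝒜 n` is a polynomial ring over `k` in finitely many
homogeneous generators of (possibly different) positive degrees. -/
def IsGradedPolynomialRing : Prop :=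
  ∃ (r : ℕ) (d : Fin r → ℕ) (x : Fin r → B),
    (∀ i, 0 < d i ∧ x i ∈ 𝒜 (d i)) ∧
      AlgebraicIndependent k x ∧ Algebra.adjoin k (Set.range x) = ⊤

/-- `G` acts on `B` by degree-preserving maps. -/
class IsGradedAction (G : Type*) [Group G] [MulSemiringAction G B] : Prop where
  smul_mem : ∀ (g : G) (n : ℕ) (b : B), b ∈ 𝒜 n → g • b ∈ 𝒜 n

/-- The irrelevant ideal `𝔪_B = ⨁_{n > 0} 𝒜 n`. -/
abbrev irrelevantIdeal [GradedAlgebra 𝒜] : Ideal B := (HomogeneousIdeal.irrelevant 𝒜).toIdeal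

/-- The irrelevant ideal `𝔪_A = 𝔪_B ∩ A` of the graded ring of invariants `A = B^G`. -/
abbrev invariantIrrelevantIdeal [GradedAlgebra 𝒜] (G : Type*) [Group G] [MulSemiringAction G B]
    [SMulCommClass G k B] : Ideal (FixedPoints.subalgebra k B G) :=
  (irrelevantIdeal 𝒜).comap (algebraMap (FixedPoints.subalgebra k B G) B)

end Grading

section Small

/-- The codimension of a closed subset of an affine scheme (`⊤` for the empty set). -/
def specCodim {B : Type*} [CommRing B] (Z : Set (PrimeSpectrum B)) : ℕ∞ :=
  ⨅ x ∈ Z, x.asIdeal.height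

/-- The action of `G` on `B` is small: there is a `G`-stable open subset `U` of `Spec B`, with
complement of codimension at least two, on which `G` acts freely. Freeness (no nontrivial element
of `G` fixes a point of `U` with values in a field) says that all points of `U` have trivial
inertia group. -/
def IsSmallAction (G B : Type*) [Group G] [CommRing B] [MulSemiringAction G B] : Prop :=
  ∃ U : TopologicalSpace.Opens (PrimeSpectrum B),
    (∀ (g : G), ∀ x ∈ U, PrimeSpectrum.comap (MulSemiringAction.toRingHom G B g) x ∈ U) ∧
    (∀ x ∈ U, x.asIdeal.inertia G = ⊥) ∧
    2 ≤ specCodim (U : Set (PrimeSpectrum B))ᶜ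

end Small

section Completion

variable {B : Type*} [CommRing B]

/-- The ideal `I` is stable under `G`. -/
class IsStableIdeal (G : Type*) [Group G] [MulSemiringAction G B] (I : Ideal B) : Prop where
  smul_mem : ∀ (g : G) (b : B), b ∈ I → g • b ∈ I

variable (G : Type*) [Group G] [MulSemiringAction G B] (I : Ideal B) [IsStableIdeal G I]

theorem pow_le_comap_of_isStableIdeal (g : G) (n : ℕ) :
    I ^ n ≤ (I ^ n).comap (MulSemiringAction.toRingHom G B g) := by
  have h : I ≤ I.comap (MulSemiringAction.toRingHom G B g) :=
    fun b hb => IsStableIdeal.smul_mem g b hb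
  exact (Ideal.pow_right_mono h n).trans (Ideal.le_comap_pow _ n)

/-- The map `b ↦ g • b` on `B ⧸ I ^ n`. -/
def quotientPowSMul (g : G) (n : ℕ) : B ⧸ I ^ n →+* B ⧸ I ^ n :=
  Ideal.quotientMap (I ^ n) (MulSemiringAction.toRingHom G B g)
    (pow_le_comap_of_isStableIdeal G I g n)

theorem factorPow_comp_quotientPowSMul (g : G) {m n : ℕ} (hle : m ≤ n) :
    (Ideal.Quotient.factorPow I hle).comp (quotientPowSMul G I g n) =
      (quotientPowSMul G I g m).comp (Ideal.Quotient.factorPow I hle) := by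
  ext b
  rfl

theorem factorPow_evalₐ {m n : ℕ} (hle : m ≤ n) (x : AdicCompletion I B) :
    Ideal.Quotient.factorPow I hle (AdicCompletion.evalₐ I n x) = AdicCompletion.evalₐ I m x := by
  induction x using AdicCompletion.induction_on with
  | _ a =>
    rw [AdicCompletion.evalₐ_mk, AdicCompletion.evalₐ_mk]
    have h := a.property hle
    rw [SModEq.sub_mem] at h
    refine Ideal.Quotient.eq.mpr ?_
    simpa using neg_mem h

theorem factorPow_comp_quotientPowSMul_evalₐ (g : G) {m n : ℕ} (hle : m ≤ n) :
    (Ideal.Quotient.factorPow I hle).comp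
        ((quotientPowSMul G I g n).comp (AdicCompletion.evalₐ I n : AdicCompletion I B →+* B ⧸ I ^ n)) =
      (quotientPowSMul G I g m).comp (AdicCompletion.evalₐ I m : AdicCompletion I B →+* B ⧸ I ^ m) := by
  rw [← RingHom.comp_assoc, factorPow_comp_quotientPowSMul, RingHom.comp_assoc]
  congr 1
  ext x
  exact factorPow_evalₐ I hle x

/-- The ring endomorphism induced by `b ↦ g • b` on the `I`-adic completion of `B`. -/
def completionSMul (g : G) : AdicCompletion I B →+* AdicCompletion I B :=
  AdicCompletion.liftRingHom I
    (fun n => (quotientPowSMul G I g n).comp (AdicCompletion.evalₐ I n : AdicCompletion I B →+* B ⧸ I ^ n))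
    (fun hle => factorPow_comp_quotientPowSMul_evalₐ G I g hle)

theorem evalₐ_completionSMul (g : G) (n : ℕ) (x : AdicCompletion I B) :
    AdicCompletion.evalₐ I n (completionSMul G I g x) =
      quotientPowSMul G I g n (AdicCompletion.evalₐ I n x) :=
  AdicCompletion.evalₐ_liftRingHom I
    (fun n => (quotientPowSMul G I g n).comp (AdicCompletion.evalₐ I n : AdicCompletion I B →+* B ⧸ I ^ n))
    (fun hle => factorPow_comp_quotientPowSMul_evalₐ G I g hle) n x

/-- The action of `G` on the `I`-adic completion of `B` induced by functoriality. -/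
instance completionAction : MulSemiringAction G (AdicCompletion I B) where
  smul g x := completionSMul G I g x
  one_smul x := by
    refine AdicCompletion.ext_evalₐ fun n => ?_
    refine (evalₐ_completionSMul G I 1 n x).trans ?_
    obtain ⟨b, hb⟩ := Ideal.Quotient.mk_surjective (AdicCompletion.evalₐ I n x)
    rw [← hb]
    exact congrArg (Ideal.Quotient.mk (I ^ n)) (one_smul G b)
  mul_smul g h x := by
    refine AdicCompletion.ext_evalₐ fun n => ?_
    refine (evalₐ_completionSMul G I (g * h) n x).trans ?_
    refine Eq.trans ?_ (evalₐ_completionSMul G I g n (completionSMul G I h x)).symm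
    rw [evalₐ_completionSMul]
    obtain ⟨b, hb⟩ := Ideal.Quotient.mk_surjective (AdicCompletion.evalₐ I n x)
    rw [← hb]
    exact congrArg (Ideal.Quotient.mk (I ^ n)) (mul_smul g h b)
  smul_zero g := map_zero (completionSMul G I g)
  smul_add g := map_add (completionSMul G I g)
  smul_one g := map_one (completionSMul G I g)
  smul_mul g := map_mul (completionSMul G I g)

/-- The action on the completion extends the action on `B`. -/
theorem completion_smul_of (g : G) (b : B) :
    g • AdicCompletion.of I B b = AdicCompletion.of I B (g • b) := by
  refine AdicCompletion.ext_evalₐ fun n => ?_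
  refine (evalₐ_completionSMul G I g n _).trans ?_
  rw [AdicCompletion.evalₐ_of, AdicCompletion.evalₐ_of]
  rfl

instance completion_smulCommClass (k : Type*) [CommRing k] [Algebra k B] [SMulCommClass G k B] :
    SMulCommClass G k (AdicCompletion I B) where
  smul_comm g c x := by
    have h : g • algebraMap k (AdicCompletion I B) c = algebraMap k (AdicCompletion I B) c := by
      rw [AdicCompletion.algebraMap_apply, completion_smul_of, smul_algebraMap]
    rw [Algebra.smul_def, Algebra.smul_def, smul_mul', h]

end Completion

section GradedStable

variable {k B : Type*} [Field k] [CommRing B] [Algebra k B] (𝒜 : ℕ → Submodule k B)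
  [GradedAlgebra 𝒜] (G : Type*) [Group G] [MulSemiringAction G B]

instance isStableIdeal_irrelevantIdeal [IsGradedAction 𝒜 G] :
    IsStableIdeal G (irrelevantIdeal 𝒜) where
  smul_mem g b hb := by
    classical
    have hb0 : GradedRing.proj 𝒜 0 b = 0 := hb
    change g • b ∈ HomogeneousIdeal.irrelevant 𝒜
    rw [← DirectSum.sum_support_decompose 𝒜 b, Finset.smul_sum]
    refine sum_mem fun i _ => ?_
    rcases Nat.eq_zero_or_pos i with rfl | hi
    · have h0 : (DirectSum.decompose 𝒜 b 0 : B) = 0 := hb0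
      rw [h0, smul_zero]
      exact zero_mem _
    · exact HomogeneousIdeal.mem_irrelevant_of_mem 𝒜 hi
        (IsGradedAction.smul_mem g i _ (SetLike.coe_mem _))

end GradedStable

section Twisted

variable {k G V : Type*} [Field k] [Group G] [AddCommGroup V] [Module k V]
  (R : Type*) [CommRing R] [Algebra k R] [MulSemiringAction G R] [SMulCommClass G k R]
  (ρ : Representation k G V)

/-- The tensor product `R ⊗ V` over `k`, on which `R` acts through the left factor and `G` acts
diagonally. -/
@[nolint unusedArguments]
def TwistedTensor (_ : Representation k G V) : Type _ := R ⊗[k] V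

namespace TwistedTensor

instance : AddCommGroup (TwistedTensor R ρ) := inferInstanceAs (AddCommGroup (R ⊗[k] V))

instance : Module R (TwistedTensor R ρ) := inferInstanceAs (Module R (R ⊗[k] V))

instance : Module k (TwistedTensor R ρ) := inferInstanceAs (Module k (R ⊗[k] V))

instance : IsScalarTower k R (TwistedTensor R ρ) :=
  inferInstanceAs (IsScalarTower k R (R ⊗[k] V))

/-- The diagonal action `g (r ⊗ v) = g r ⊗ g v`. -/
def diag : Representation k G (TwistedTensor R ρ) :=
  (Representation.ofDistribMulAction k G R).tprod ρ

theorem diag_tmul (g : G) (r : R) (v : V) :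
    diag R ρ g (show TwistedTensor R ρ from r ⊗ₜ[k] v) =
      (show TwistedTensor R ρ from (g • r) ⊗ₜ[k] ρ g v) := rfl

theorem diag_smul (g : G) (r : R) (x : TwistedTensor R ρ) :
    diag R ρ g (r • x) = (g • r) • diag R ρ g x := by
  refine TensorProduct.induction_on x ?_ ?_ ?_
  · exact ((congrArg (diag R ρ g) (smul_zero r)).trans (map_zero _)).trans
      ((congrArg ((g • r) • ·) (map_zero (diag R ρ g))).trans (smul_zero _)).symm
  · intro s v
    change (g • (r * s)) ⊗ₜ[k] ρ g v = ((g • r) * (g • s)) ⊗ₜ[k] ρ g v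
    rw [smul_mul']
  · intro a b ha hb
    refine ((congrArg (diag R ρ g) (smul_add r a b)).trans (map_add _ _ _)).trans ?_
    refine Eq.trans ?_
      ((congrArg ((g • r) • ·) (map_add (diag R ρ g) a b)).trans (smul_add _ _ _)).symm
    exact congrArg₂ (· + ·) ha hb

/-- The ring homomorphism from the twisted group algebra `R * G`, in which
`(r g) (r' g') = (r (g r')) (g g')`, to the endomorphisms of `R ⊗ V`, which sends `r g` to
`x ↦ r • g x`. -/
def twistedHom : SkewMonoidAlgebra R G →+* Module.End k (TwistedTensor R ρ) :=
  SkewMonoidAlgebra.liftNCRingHom (Algebra.lsmul k k (TwistedTensor R ρ)).toRingHom (diag R ρ)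
    (fun {r g} => LinearMap.ext fun x => (diag_smul R ρ g r x).symm)

/-- `R ⊗ V` as a module over the twisted group algebra `R * G`. -/
instance : Module (SkewMonoidAlgebra R G) (TwistedTensor R ρ) :=
  Module.compHom _ (twistedHom R ρ)

theorem single_smul (g : G) (r : R) (x : TwistedTensor R ρ) :
    SkewMonoidAlgebra.single g r • x = r • diag R ρ g x := by
  change twistedHom R ρ (SkewMonoidAlgebra.single g r) x = _
  unfold twistedHom
  erw [SkewMonoidAlgebra.liftNC_single]
  rfl

/-- The module of invariants `(R ⊗ V)^G` over the ring of invariants `R^G`. -/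
def invariants : Submodule (FixedPoints.subalgebra k R G) (TwistedTensor R ρ) where
  carrier := {x | ∀ g : G, diag R ρ g x = x}
  zero_mem' g := map_zero _
  add_mem' {x y} hx hy g := by rw [map_add, hx g, hy g]
  smul_mem' a x hx g := by
    change diag R ρ g ((a : R) • x) = (a : R) • x
    rw [diag_smul, hx g, a.property g]

end TwistedTensor

end Twisted

end

set_option linter.unusedSectionVars false

section Indecomposable

variable {S M : Type*} [Ring S] [AddCommGroup M] [Module S M]

theorem isIndecomposableModule_iff_end :
    IsIndecomposableModule S M ↔
      Nontrivial (Module.End S M) ∧ ∀ e : Module.End S M, IsIdempotentElem e → e = 0 ∨ e = 1 := by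
  constructor
  · rintro ⟨hM, h⟩
    refine ⟨inferInstance, fun e he => ?_⟩
    rcases h _ _ (LinearMap.IsIdempotentElem.isCompl he) with h0 | h0
    · exact Or.inl (LinearMap.range_eq_bot.mp h0)
    · refine Or.inr (LinearMap.ext fun x => ?_)
      refine LinearMap.ker_eq_bot.mp h0 ?_
      exact congrArg (fun f : Module.End S M => f x) he
  · rintro ⟨hM, h⟩
    refine ⟨?_, fun N N' hc => ?_⟩
    · by_contra hM'
      rw [not_nontrivial_iff_subsingleton] at hM'
      exact not_subsingleton (Module.End S M) inferInstance
    · rcases h _ (Submodule.isIdempotentElem_projection hc) with h0 | h0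
      · left
        rw [← Submodule.range_projection hc, h0, LinearMap.range_zero]
      · right
        rw [← Submodule.ker_projection hc, h0]
        exact LinearMap.ker_id

/-- Indecomposability descends along an injective ring homomorphism of endomorphism rings. -/
theorem IsIndecomposableModule.of_injective_ringHom {T N : Type*} [Ring T] [AddCommGroup N]
    [Module T N] (F : Module.End T N →+* Module.End S M) (hF : Function.Injective F)
    (h : IsIndecomposableModule S M) : IsIndecomposableModule T N := by
  rw [isIndecomposableModule_iff_end] at h ⊢
  obtain ⟨h1, h2⟩ := h
  refine ⟨F.domain_nontrivial, fun e he => ?_⟩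
  refine (h2 (F e) (he.map F)).imp (fun h0 => hF ?_) fun h0 => hF ?_
  · rw [h0, map_zero]
  · rw [h0, map_one]

/-- Indecomposability lifts along a ring homomorphism of endomorphism rings whose kernel contains
no nonzero idempotents. -/
theorem IsIndecomposableModule.of_ringHom {T N : Type*} [Ring T] [AddCommGroup N]
    [Module T N] (F : Module.End T N →+* Module.End S M)
    (hF : ∀ e, IsIdempotentElem e → F e = 0 → e = 0)
    (h : IsIndecomposableModule S M) : IsIndecomposableModule T N := by
  rw [isIndecomposableModule_iff_end] at h ⊢
  obtain ⟨h1, h2⟩ := h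
  refine ⟨F.domain_nontrivial, fun e he => ?_⟩
  refine (h2 (F e) (he.map F)).imp (fun h0 => hF e he h0) fun h0 => ?_
  have := hF (1 - e) he.one_sub (by rw [map_sub, map_one, h0, sub_self])
  exact (sub_eq_zero.mp this).symm

end Indecomposable

section Freeness

variable (G B : Type*) [Group G] [CommRing B] [MulSemiringAction G B]

/-- The `B`-span of the orbit maps `g ↦ g • b` in the algebra of functions `G → B`. -/
noncomputable def orbitSpan : Submodule B (G → B) :=
  Submodule.span B (Set.range fun (b : B) (g : G) => g • b)

open Classical in
/-- The ideal of all `s` such that `s` times the indicator function of `1` is a `B`-linear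
combination of orbit maps. -/
noncomputable def freenessIdeal : Ideal B :=
  (orbitSpan G B).comap (LinearMap.single B (fun _ : G => B) 1)

variable {G B}

theorem orbitSpan_mul_mem {f f' : G → B} (hf : f ∈ orbitSpan G B) (hf' : f' ∈ orbitSpan G B) :
    f * f' ∈ orbitSpan G B := by
  have h := Submodule.mul_mem_mul hf hf'
  rw [orbitSpan, Submodule.span_mul_span] at h
  refine Submodule.span_mono ?_ h
  rintro _ ⟨_, ⟨b, rfl⟩, _, ⟨b', rfl⟩, rfl⟩
  exact ⟨b * b', funext fun g => smul_mul' g b b'⟩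

theorem one_mem_orbitSpan : (1 : G → B) ∈ orbitSpan G B :=
  Submodule.subset_span ⟨1, funext fun g => smul_one g⟩

theorem not_freenessIdeal_le_of_inertia_eq_bot [Finite G] (p : Ideal B) [p.IsPrime]
    (h : p.inertia G = ⊥) : ¬ freenessIdeal G B ≤ p := by
  classical
  have := Fintype.ofFinite G
  have key : ∀ g : G, ∃ f ∈ orbitSpan G B, f 1 ∉ p ∧ (g ≠ 1 → f g = 0) := by
    intro g
    by_cases hg : g = 1
    · exact ⟨1, one_mem_orbitSpan, fun h1 => Ideal.IsPrime.ne_top ‹_› ((Ideal.eq_top_iff_one p).mpr h1),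
        fun h => absurd hg h⟩
    · have hg' : g⁻¹ ∉ p.inertia G := by
        rw [h, Subgroup.mem_bot, inv_eq_one]
        exact hg
      have hg'' : ∃ y, g⁻¹ • y - y ∉ p := by
        by_contra! hcon
        exact hg' hcon
      obtain ⟨y, hy⟩ := hg''
      refine ⟨y • 1 - fun h => h • g⁻¹ • y, sub_mem (Submodule.smul_mem _ _ one_mem_orbitSpan)
        (Submodule.subset_span ⟨_, rfl⟩), ?_, fun _ => ?_⟩
      · rw [← neg_mem_iff]
        simpa using hy
      · simp
  choose f hf hf1 hfg using key
  intro hle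
  have hprod : ∏ g, f g ∈ orbitSpan G B :=
    Finset.prod_induction f (· ∈ orbitSpan G B) (fun _ _ => orbitSpan_mul_mem) one_mem_orbitSpan
      fun g _ => hf g
  have hsingle : (∏ g, f g) = Pi.single 1 ((∏ g, f g) 1) := by
    funext h
    by_cases hh : h = 1
    · subst hh
      simp
    · rw [Pi.single_eq_of_ne hh, Finset.prod_apply]
      exact Finset.prod_eq_zero (Finset.mem_univ h) (hfg h hh)
  have hmem : (∏ g, f g) 1 ∈ p := hle (by
    change Pi.single 1 ((∏ g, f g) 1) ∈ orbitSpan G B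
    rwa [← hsingle])
  rw [Finset.prod_apply, Ideal.IsPrime.prod_mem_iff] at hmem
  obtain ⟨g, -, hg⟩ := hmem
  exact hf1 g hg

theorem not_freenessIdeal_le_of_height_le_one [Finite G] (h : IsSmallAction G B)
    (p : Ideal B) [hp : p.IsPrime] (hht : p.height ≤ 1) : ¬ freenessIdeal G B ≤ p := by
  obtain ⟨U, -, hfree, hcodim⟩ := h
  refine not_freenessIdeal_le_of_inertia_eq_bot p (hfree ⟨p, hp⟩ ?_)
  by_contra hU
  have h2 : (2 : ℕ∞) ≤ p.height := hcodim.trans (iInf₂_le (⟨p, hp⟩ : PrimeSpectrum B) hU)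
  exact absurd (h2.trans hht) (by decide)

/-- The freeness ideal of a small action contains two relatively prime elements. -/
theorem exists_isRelPrime_mem_freenessIdeal [Finite G] [IsDomain B] [IsNoetherianRing B]
    [UniqueFactorizationMonoid B] (h : IsSmallAction G B) :
    ∃ s ∈ freenessIdeal G B, ∃ t ∈ freenessIdeal G B, s ≠ 0 ∧ IsRelPrime s t := by
  classical
  have hbot : ¬ freenessIdeal G B ≤ ⊥ :=
    not_freenessIdeal_le_of_height_le_one h ⊥ (by simp)
  obtain ⟨s, hs, hs0⟩ := SetLike.not_le_iff_exists.mp hbot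
  rw [Ideal.mem_bot] at hs0
  have hprime : ∀ q ∈ (UniqueFactorizationMonoid.factors s).toFinset, Prime q := fun q hq =>
    UniqueFactorizationMonoid.prime_of_factor q (Multiset.mem_toFinset.mp hq)
  have havoid : ¬ ((freenessIdeal G B : Ideal B) : Set B) ⊆
      ⋃ q ∈ ((UniqueFactorizationMonoid.factors s).toFinset : Set B), (Ideal.span {q} : Ideal B) := by
    rw [Ideal.subset_union_prime 0 0 fun q hq _ _ =>
      (Ideal.span_singleton_prime (hprime q hq).ne_zero).mpr (hprime q hq)]
    rintro ⟨q, hq, hle⟩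
    have hqp : (Ideal.span {q}).IsPrime :=
      (Ideal.span_singleton_prime (hprime q hq).ne_zero).mpr (hprime q hq)
    refine not_freenessIdeal_le_of_height_le_one h (Ideal.span {q}) ?_ hle
    refine Ideal.height_le_one_of_isPrincipal_of_mem_minimalPrimes (Ideal.span {q}) _ ?_
    exact ⟨⟨hqp, le_rfl⟩, fun J hJ _ => hJ.2⟩
  obtain ⟨t, ht, htq⟩ := Set.not_subset.mp havoid
  refine ⟨s, hs, t, ht, hs0, UniqueFactorizationMonoid.isRelPrime_iff_no_prime_factors hs0 |>.mpr ?_⟩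
  intro q hqs hqt hq
  obtain ⟨r, hr, hqr⟩ := UniqueFactorizationMonoid.exists_mem_factors_of_dvd hs0 hq.irreducible hqs
  refine htq (Set.mem_iUnion₂.mpr ⟨r, by simpa using hr, ?_⟩)
  exact Ideal.mem_span_singleton.mpr (hqr.symm.dvd.trans hqt)

end Freeness

section Extension

variable {k G B N N' : Type*} [CommRing k] [Group G] [CommRing B] [Algebra k B]
  [MulSemiringAction G B] [SMulCommClass G k B]
  [AddCommGroup N] [Module k N] [Module B N] {σ : Representation k G N}
  [AddCommGroup N'] [Module k N'] [Module B N'] {σ' : Representation k G N'}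

theorem sum_smul_smul_mem_invariants [Fintype G] (hσ : ∀ g (b : B) x, σ g (b • x) = (g • b) • σ g x)
    (y : B) (x : N) (h : G) : σ h (∑ g, (g • y) • σ g x) = ∑ g, (g • y) • σ g x := by
  rw [map_sum]
  refine Fintype.sum_equiv (Equiv.mulLeft h) _ _ fun g => ?_
  rw [hσ, Equiv.coe_mulLeft, mul_smul, map_mul, Module.End.mul_apply]

variable (M : Submodule (FixedPoints.subalgebra k B G) N) (hM : ∀ x, x ∈ M ↔ ∀ g, σ g x = x)
  (hσ : ∀ g (b : B) x, σ g (b • x) = (g • b) • σ g x)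

include hM hσ in
theorem smul_mem_span_of_mem_freenessIdeal [Finite G] {s : B} (hs : s ∈ freenessIdeal G B) (x : N) :
    s • x ∈ Submodule.span B (M : Set N) := by
  classical
  have := Fintype.ofFinite G
  have key : ∀ f ∈ orbitSpan G B, ∑ g, f g • σ g x ∈ Submodule.span B (M : Set N) := by
    intro f hf
    induction hf using Submodule.span_induction with
    | mem f hf =>
      obtain ⟨y, rfl⟩ := hf
      exact Submodule.subset_span ((hM _).mpr (sum_smul_smul_mem_invariants hσ y x))
    | zero => simp
    | add f f' _ _ h h' => simpa [add_smul, Finset.sum_add_distrib] using add_mem h h'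
    | smul b f _ h => simpa [mul_smul, Finset.smul_sum] using Submodule.smul_mem _ b h
  have h := key _ hs
  rw [Fintype.sum_eq_single (1 : G)] at h
  · simpa using h
  · intro g hg
    simp [Pi.single_eq_of_ne hg]

theorem smul_eq_zero_of_mem_freenessIdeal [Fintype G] {s : B} (hs : s ∈ freenessIdeal G B) (x : N)
    (hx : ∀ y : B, ∑ g : G, (g • y) • σ g x = 0) : s • x = 0 := by
  classical
  have key : ∀ f ∈ orbitSpan G B, ∑ g, f g • σ g x = 0 := by
    intro f hf
    induction hf using Submodule.span_induction with
    | mem f hf =>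
      obtain ⟨y, rfl⟩ := hf
      exact hx y
    | zero => simp
    | add f f' _ _ h h' => simp [add_smul, Finset.sum_add_distrib, h, h']
    | smul b f _ h => simp [mul_smul, ← Finset.smul_sum, h]
  have h := key _ hs
  rw [Fintype.sum_eq_single (1 : G)] at h
  · simpa using h
  · intro g hg
    simp [Pi.single_eq_of_ne hg]

include hM hσ in
theorem linearMap_eq_of_eqOn_invariants [Finite G] {s : B} (hs : s ∈ freenessIdeal G B)
    (hs0 : ∀ n : N', s • n = 0 → n = 0) (ψ ψ' : N →ₗ[B] N') (h : ∀ x ∈ M, ψ x = ψ' x) :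
    ψ = ψ' := by
  refine LinearMap.ext fun x => sub_eq_zero.mp (hs0 _ ?_)
  rw [smul_sub, ← map_smul, ← map_smul, sub_eq_zero]
  exact LinearMap.eqOn_span (f := ψ) (g := ψ') (fun y hy => h y hy)
    (smul_mem_span_of_mem_freenessIdeal M hM hσ hs x)

include hM hσ in
/-- A linear map over the ring of invariants between modules of invariants extends to an
equivariant linear map when the freeness ideal contains a sequence that is regular on the target. -/
theorem exists_equivariant_extension [Finite G] (hσ' : ∀ g (b : B) x, σ' g (b • x) = (g • b) • σ' g x)
    {s t : B} (hs : s ∈ freenessIdeal G B) (ht : t ∈ freenessIdeal G B)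
    (hs0 : ∀ n : N', s • n = 0 → n = 0)
    (hst : ∀ n n' : N', t • n = s • n' → ∃ n'', n = s • n'')
    (φ : M → N') (hadd : ∀ x y, φ (x + y) = φ x + φ y)
    (hsmul : ∀ (a : FixedPoints.subalgebra k B G) x, φ (a • x) = (a : B) • φ x)
    (hφ : ∀ x g, σ' g (φ x) = φ x) :
    ∃ ψ : N →ₗ[B] N', (∀ x : M, ψ x = φ x) ∧ ∀ g x, ψ (σ g x) = σ' g (ψ x) := by
  classical
  have := Fintype.ofFinite G
  let L : (M →₀ B) →ₗ[B] N := Finsupp.linearCombination B (fun z : M => (z : N))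
  let L' : (M →₀ B) →ₗ[B] N' := Finsupp.linearCombination B φ
  let tr : B → FixedPoints.subalgebra k B G := fun b => ⟨∑ g : G, g • b, fun h => by
    change h • ∑ g : G, g • b = _
    rw [Finset.smul_sum]
    exact Fintype.sum_equiv (Equiv.mulLeft h) _ _ fun g => by simp [mul_smul]⟩
  have htr : ∀ b, ((tr b : FixedPoints.subalgebra k B G) : B) = ∑ g : G, g • b := fun _ => rfl
  let φ' : M →ₗ[FixedPoints.subalgebra k B G] N' := { toFun := φ, map_add' := hadd, map_smul' := hsmul }
  have hker : ∀ l, L l = 0 → L' l = 0 := by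
    intro l hl
    refine hs0 _ (smul_eq_zero_of_mem_freenessIdeal (σ := σ') hs _ fun y => ?_)
    have e1 : ∑ z ∈ l.support, tr (y * l z) • z = 0 := by
      apply Subtype.ext
      have e2 : ∑ g : G, (g • y) • σ g (L l) = 0 := by simp [hl]
      rw [ZeroMemClass.coe_zero, ← e2]
      simp only [L, Finsupp.linearCombination_apply, Finsupp.sum, map_sum, Finset.smul_sum,
        AddSubmonoidClass.coe_finsetSum]
      rw [Finset.sum_comm]
      refine Finset.sum_congr rfl fun z _ => ?_
      rw [Submodule.coe_smul]
      change ((tr (y * l z) : FixedPoints.subalgebra k B G) : B) • (z : N) = _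
      rw [htr, Finset.sum_smul]
      refine Finset.sum_congr rfl fun g _ => ?_
      rw [hσ, (hM z).mp z.2, smul_mul', mul_smul]
    have e3 := congrArg φ' e1
    rw [map_zero, map_sum] at e3
    rw [← e3]
    simp only [L', Finsupp.linearCombination_apply, Finsupp.sum, map_sum, Finset.smul_sum]
    rw [Finset.sum_comm]
    refine Finset.sum_congr rfl fun z _ => ?_
    change _ = φ (tr (y * l z) • z)
    rw [hsmul, htr, Finset.sum_smul]
    refine Finset.sum_congr rfl fun g _ => ?_
    rw [hσ', hφ, smul_mul', mul_smul]
  have hrange : ∀ s ∈ freenessIdeal G B, ∀ x : N, ∃ l, L l = s • x := by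
    intro s hs x
    have h := smul_mem_span_of_mem_freenessIdeal M hM hσ hs x
    rw [← Subtype.range_coe (s := (M : Set N)), ← Finsupp.range_linearCombination] at h
    exact h
  have hex : ∀ x : N, ∃ n : N', ∀ l, L l = s • x → L' l = s • n := by
    intro x
    obtain ⟨l₁, h₁⟩ := hrange s hs x
    obtain ⟨l₂, h₂⟩ := hrange t ht x
    obtain ⟨n, hn⟩ := hst (L' l₁) (L' l₂) (by
      rw [← map_smul, ← map_smul, ← sub_eq_zero, ← map_sub]
      apply hker
      rw [map_sub, map_smul, map_smul, h₁, h₂, smul_comm, sub_self])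
    refine ⟨n, fun l hl => ?_⟩
    rw [← hn, ← sub_eq_zero, ← map_sub]
    apply hker
    rw [map_sub, hl, h₁, sub_self]
  choose f hf using hex
  have hcancel : ∀ n n' : N', s • n = s • n' → n = n' := fun n n' h =>
    sub_eq_zero.mp (hs0 _ (by rw [smul_sub, h, sub_self]))
  let ψ : N →ₗ[B] N' :=
    { toFun := f
      map_add' := fun x y => by
        obtain ⟨l₁, h₁⟩ := hrange s hs x
        obtain ⟨l₂, h₂⟩ := hrange s hs y
        apply hcancel
        rw [smul_add, ← hf x l₁ h₁, ← hf y l₂ h₂, ← map_add]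
        exact (hf _ _ (by rw [map_add, h₁, h₂, smul_add])).symm
      map_smul' := fun b x => by
        obtain ⟨l, hl⟩ := hrange s hs x
        apply hcancel
        rw [RingHom.id_apply, smul_comm s b, ← hf x l hl, ← map_smul]
        exact (hf _ _ (by rw [map_smul, hl, smul_comm])).symm }
  have hψ : ∀ x : M, ψ x = φ x := by
    intro x
    apply hcancel
    change s • f x = _
    rw [← hf x (Finsupp.single x s) (by simp [L])]
    simp [L']
  refine ⟨ψ, hψ, fun g x => ?_⟩
  let ψ' : N →ₗ[B] N' :=
    { toFun := fun x => σ' g⁻¹ (ψ (σ g x))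
      map_add' := fun x y => by simp only [map_add]
      map_smul' := fun b x => by
        rw [hσ, map_smul, hσ', inv_smul_smul, RingHom.id_apply] }
  have hψ' : ψ' = ψ := by
    refine linearMap_eq_of_eqOn_invariants M hM hσ hs hs0 _ _ fun x hx => ?_
    change σ' g⁻¹ (ψ (σ g x)) = ψ x
    rw [(hM x).mp hx g, hψ ⟨x, hx⟩, hφ]
  have h : σ' g⁻¹ (ψ (σ g x)) = ψ x := LinearMap.congr_fun hψ' x
  rw [← h]
  simp

end Extension

section InducedHoms

variable {S D D' T N N' : Type*} [Ring S] [AddCommGroup D] [Module S D] [AddCommGroup D']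
  [Module S D'] [Ring T] [AddCommGroup N] [Module T N] [AddCommGroup N'] [Module T N']

/-- If every endomorphism of `D` is induced along `θ` by a unique endomorphism of `N`, this
correspondence is a ring homomorphism. -/
noncomputable def Module.End.ringHomOfExistsUnique (θ : D →+ N)
    (h : ∀ f : Module.End S D, ∃! ψ : Module.End T N, ∀ x, ψ (θ x) = θ (f x)) :
    Module.End S D →+* Module.End T N where
  toFun f := (h f).choose
  map_one' := ((h 1).choose_spec.2 1 fun _ => rfl).symm
  map_zero' := ((h 0).choose_spec.2 0 fun _ => (map_zero θ).symm).symm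
  map_mul' f f' := ((h (f * f')).choose_spec.2 _ fun x => by
    rw [Module.End.mul_apply, (h f').choose_spec.1, (h f).choose_spec.1]
    rfl).symm
  map_add' f f' := ((h (f + f')).choose_spec.2 _ fun x => by
    rw [LinearMap.add_apply, (h f').choose_spec.1, (h f).choose_spec.1, LinearMap.add_apply,
      map_add]).symm

theorem Module.End.ringHomOfExistsUnique_apply (θ : D →+ N)
    (h : ∀ f : Module.End S D, ∃! ψ : Module.End T N, ∀ x, ψ (θ x) = θ (f x))
    (f : Module.End S D) (x : D) : ringHomOfExistsUnique θ h f (θ x) = θ (f x) :=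
  (h f).choose_spec.1 x

theorem Module.End.ringHomOfExistsUnique_injective (θ : D →+ N)
    (h : ∀ f : Module.End S D, ∃! ψ : Module.End T N, ∀ x, ψ (θ x) = θ (f x))
    (hθ : Function.Injective θ) : Function.Injective (ringHomOfExistsUnique θ h) := by
  intro f f' hf
  refine LinearMap.ext fun x => hθ ?_
  rw [← ringHomOfExistsUnique_apply θ h, ← ringHomOfExistsUnique_apply θ h, hf]

theorem nonempty_linearEquiv_of_existsUnique (θ : D →+ N) (θ' : D' →+ N')
    (h : ∀ f : D →ₗ[S] D', ∃ ψ : N →ₗ[T] N', ∀ x, ψ (θ x) = θ' (f x))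
    (h' : ∀ f : D' →ₗ[S] D, ∃ ψ : N' →ₗ[T] N, ∀ x, ψ (θ' x) = θ (f x))
    (huniq : ∀ ψ ψ' : Module.End T N, (∀ x, ψ (θ x) = ψ' (θ x)) → ψ = ψ')
    (huniq' : ∀ ψ ψ' : Module.End T N', (∀ x, ψ (θ' x) = ψ' (θ' x)) → ψ = ψ') :
    Nonempty (D ≃ₗ[S] D') → Nonempty (N ≃ₗ[T] N') := by
  rintro ⟨f⟩
  obtain ⟨ψ, hψ⟩ := h f.toLinearMap
  obtain ⟨ψ', hψ'⟩ := h' f.symm.toLinearMap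
  refine ⟨LinearEquiv.ofLinearMap ψ ψ' (huniq' _ LinearMap.id fun x => ?_)
    (huniq _ LinearMap.id fun x => ?_)⟩
  · simp [hψ, hψ']
  · simp [hψ, hψ']

end InducedHoms

namespace Representation

variable {k G V V' : Type*} [Field k] [Group G] [AddCommGroup V] [Module k V]
  [AddCommGroup V'] [Module k V'] {ρ : Representation k G V} {ρ' : Representation k G V'}

/-- The `k`-linear map underlying a map of `kG`-modules. -/
noncomputable def asModuleHomToLinearMap (f : ρ.asModule →ₗ[MonoidAlgebra k G] ρ'.asModule) : V →ₗ[k] V' :=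
  ((IntertwiningMap.equivLinearMapAsModule ρ ρ').symm f).toLinearMap

theorem asModuleHomToLinearMap_rho (f : ρ.asModule →ₗ[MonoidAlgebra k G] ρ'.asModule) (g : G)
    (v : V) :
    asModuleHomToLinearMap f (ρ g v) = ρ' g (asModuleHomToLinearMap f v) :=
  IntertwiningMap.isIntertwining _ _ ((IntertwiningMap.equivLinearMapAsModule ρ ρ').symm f) g v

/-- The map of `kG`-modules given by an equivariant `k`-linear map. -/
noncomputable def asModuleHomOfEquivariant (h : V →ₗ[k] V') (hh : ∀ g v, h (ρ g v) = ρ' g (h v)) :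
    ρ.asModule →ₗ[MonoidAlgebra k G] ρ'.asModule :=
  IntertwiningMap.equivLinearMapAsModule ρ ρ' ⟨h, fun g => LinearMap.ext (hh g)⟩

end Representation

namespace TwistedTensor

variable {k G V V' : Type*} [Field k] [Group G] [AddCommGroup V] [Module k V]
  [AddCommGroup V'] [Module k V']
  (C : Type*) [CommRing C] [Algebra k C] [MulSemiringAction G C] [SMulCommClass G k C]
  (ρ : Representation k G V) (ρ' : Representation k G V')

/-- The pure tensor `c ⊗ v`. -/
def tmul (c : C) (v : V) : TwistedTensor C ρ := c ⊗ₜ[k] v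

variable {C ρ ρ'}

theorem induction_on {p : TwistedTensor C ρ → Prop} (x : TwistedTensor C ρ)
    (h : ∀ c v, p (tmul C ρ c v)) (hadd : ∀ x y, p x → p y → p (x + y)) : p x := by
  have h0 : p (0 : TwistedTensor C ρ) := by
    have h0 : tmul C ρ 0 0 = 0 := TensorProduct.zero_tmul C (0 : V)
    exact h0 ▸ h 0 0
  exact TensorProduct.induction_on (motive := p) x h0 h hadd

variable (C ρ) in
theorem diag_tmul' (g : G) (c : C) (v : V) :
    diag C ρ g (tmul C ρ c v) = tmul C ρ (g • c) (ρ g v) := rfl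

theorem smul_tmul' (a c : C) (v : V) : a • tmul C ρ c v = tmul C ρ (a * c) v := rfl

theorem tmul_eq_smul (c : C) (v : V) : tmul C ρ c v = c • tmul C ρ 1 v := by
  rw [smul_tmul', mul_one]

variable (C ρ) in
/-- The `k`-linear map `v ↦ 1 ⊗ v`. -/
def incl : V →ₗ[k] TwistedTensor C ρ := TensorProduct.mk k C V 1

theorem incl_apply (v : V) : incl C ρ v = tmul C ρ 1 v := rfl

variable (C ρ) in
/-- The map `v ↦ 1 ⊗ v` on the `kG`-module of a representation. -/
def inclHom : ρ.asModule →+ TwistedTensor C ρ :=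
  (incl C ρ).toAddMonoidHom.comp ρ.asModuleEquiv.toAddMonoidHom

variable (C ρ) in
/-- The `C`-basis of `C ⊗ V` given by a `k`-basis of `V`. -/
noncomputable def basis : Module.Basis (Module.Basis.ofVectorSpaceIndex k V) C (TwistedTensor C ρ) :=
  (Module.Basis.ofVectorSpace k V).baseChange C

theorem map_smul_of_linear (ψ : TwistedTensor C ρ →ₗ[SkewMonoidAlgebra C G] TwistedTensor C ρ')
    (c : C) (x : TwistedTensor C ρ) : ψ (c • x) = c • ψ x := by
  have h := map_smul ψ (SkewMonoidAlgebra.single 1 c) x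
  rwa [single_smul, single_smul, map_one, map_one] at h

theorem map_diag_of_linear (ψ : TwistedTensor C ρ →ₗ[SkewMonoidAlgebra C G] TwistedTensor C ρ')
    (g : G) (x : TwistedTensor C ρ) : ψ (diag C ρ g x) = diag C ρ' g (ψ x) := by
  have h := map_smul ψ (SkewMonoidAlgebra.single g 1) x
  rwa [single_smul, single_smul, one_smul, one_smul] at h

/-- A linear map over the twisted group algebra is linear over the coefficient ring. -/
noncomputable def toLinearMap (ψ : TwistedTensor C ρ →ₗ[SkewMonoidAlgebra C G] TwistedTensor C ρ') :
    TwistedTensor C ρ →ₗ[C] TwistedTensor C ρ' where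
  toFun := ψ
  map_add' := map_add ψ
  map_smul' := map_smul_of_linear ψ

theorem toLinearMap_apply (ψ : TwistedTensor C ρ →ₗ[SkewMonoidAlgebra C G] TwistedTensor C ρ')
    (x : TwistedTensor C ρ) : toLinearMap ψ x = ψ x := rfl

/-- An equivariant linear map is linear over the twisted group algebra. -/
noncomputable def ofEquivariant (ψ : TwistedTensor C ρ →ₗ[C] TwistedTensor C ρ')
    (hψ : ∀ g x, ψ (diag C ρ g x) = diag C ρ' g (ψ x)) :
    TwistedTensor C ρ →ₗ[SkewMonoidAlgebra C G] TwistedTensor C ρ' where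
  toFun := ψ
  map_add' := map_add ψ
  map_smul' a x := by
    rw [RingHom.id_apply]
    induction a using SkewMonoidAlgebra.induction_on with
    | zero => rw [zero_smul, zero_smul, map_zero]
    | single g c => rw [single_smul, single_smul, map_smul, hψ]
    | add a b ha hb => rw [add_smul, add_smul, map_add, ha, hb]

theorem ofEquivariant_apply (ψ : TwistedTensor C ρ →ₗ[C] TwistedTensor C ρ')
    (hψ : ∀ g x, ψ (diag C ρ g x) = diag C ρ' g (ψ x)) (x : TwistedTensor C ρ) :
    ofEquivariant ψ hψ x = ψ x := rfl

theorem hom_ext {ψ ψ' : TwistedTensor C ρ →ₗ[SkewMonoidAlgebra C G] TwistedTensor C ρ'}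
    (h : ∀ v, ψ (tmul C ρ 1 v) = ψ' (tmul C ρ 1 v)) : ψ = ψ' := by
  refine LinearMap.ext fun x => ?_
  induction x using TwistedTensor.induction_on with
  | h c v => rw [tmul_eq_smul, map_smul_of_linear, map_smul_of_linear, h]
  | hadd x y hx hy => rw [map_add, map_add, hx, hy]

/-- The base change of a `k`-linear map. -/
noncomputable def baseChange (h : V →ₗ[k] V') : TwistedTensor C ρ →ₗ[C] TwistedTensor C ρ' :=
  LinearMap.baseChange C h

theorem baseChange_tmul (h : V →ₗ[k] V') (c : C) (v : V) :
    (baseChange h : TwistedTensor C ρ →ₗ[C] TwistedTensor C ρ') (tmul C ρ c v) =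
      tmul C ρ' c (h v) := rfl

theorem baseChange_diag (h : V →ₗ[k] V') (hh : ∀ g v, h (ρ g v) = ρ' g (h v)) (g : G)
    (x : TwistedTensor C ρ) :
    (baseChange h : TwistedTensor C ρ →ₗ[C] TwistedTensor C ρ') (diag C ρ g x) =
      diag C ρ' g ((baseChange h : TwistedTensor C ρ →ₗ[C] TwistedTensor C ρ') x) := by
  induction x using TwistedTensor.induction_on with
  | h c v => rw [diag_tmul', baseChange_tmul, baseChange_tmul, diag_tmul', hh]
  | hadd x y hx hy => simp only [map_add, hx, hy]

theorem existsUnique_of_asModuleHom (f : ρ.asModule →ₗ[MonoidAlgebra k G] ρ'.asModule) :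
    ∃! ψ : TwistedTensor C ρ →ₗ[SkewMonoidAlgebra C G] TwistedTensor C ρ',
      ∀ v, ψ (inclHom C ρ v) = inclHom C ρ' (f v) := by
  refine ⟨ofEquivariant (baseChange (Representation.asModuleHomToLinearMap f))
    (baseChange_diag _ (Representation.asModuleHomToLinearMap_rho f)), fun v => rfl, fun ψ hψ => ?_⟩
  exact hom_ext fun v => hψ v

section Augmentation

variable (ε : C →ₐ[k] k)

/-- The reduction `C ⊗ V → V` along an augmentation of `C`. -/
noncomputable def reduction (ρ : Representation k G V) : TwistedTensor C ρ →ₗ[k] V :=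
  (TensorProduct.lid k V).toLinearMap ∘ₗ LinearMap.rTensor V ε.toLinearMap

/-- The reduction `C ⊗ V → V` with values in the `kG`-module of the representation. -/
noncomputable def reductionHom (ρ : Representation k G V) : TwistedTensor C ρ →+ ρ.asModule :=
  ρ.asModuleEquiv.symm.toAddMonoidHom.comp (reduction ε ρ).toAddMonoidHom

theorem reduction_tmul (c : C) (v : V) : reduction ε ρ (tmul C ρ c v) = ε c • v := rfl

theorem reduction_incl (v : V) : reduction ε ρ (incl C ρ v) = v := by
  rw [incl_apply, reduction_tmul, map_one, one_smul]

theorem reductionHom_inclHom (v : ρ.asModule) : reductionHom ε ρ (inclHom C ρ v) = v :=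
  reduction_incl (ρ := ρ) ε v

theorem reduction_smul (c : C) (x : TwistedTensor C ρ) :
    reduction ε ρ (c • x) = ε c • reduction ε ρ x := by
  induction x using TwistedTensor.induction_on with
  | h c' v => rw [smul_tmul', reduction_tmul, reduction_tmul, map_mul, mul_smul]
  | hadd x y hx hy => rw [smul_add, map_add, hx, hy, map_add, smul_add]

theorem reduction_diag (hε : ∀ (g : G) c, ε (g • c) = ε c) (g : G) (x : TwistedTensor C ρ) :
    reduction ε ρ (diag C ρ g x) = ρ g (reduction ε ρ x) := by
  induction x using TwistedTensor.induction_on with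
  | h c' v => rw [diag_tmul', reduction_tmul, reduction_tmul, hε, map_smul]
  | hadd x y hx hy => rw [map_add, map_add, hx, hy, map_add, map_add]

include ε in
theorem inclHom_injective : Function.Injective (inclHom C ρ) :=
  fun v v' h => by rw [← reductionHom_inclHom (ρ := ρ) ε v, h, reductionHom_inclHom]

theorem sub_incl_reduction_mem (x : TwistedTensor C ρ) :
    x - incl C ρ (reduction ε ρ x) ∈ RingHom.ker ε • (⊤ : Submodule C (TwistedTensor C ρ)) := by
  induction x using TwistedTensor.induction_on with
  | h c v =>
    have h : tmul C ρ c v - incl C ρ (reduction ε ρ (tmul C ρ c v)) =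
        (c - algebraMap k C (ε c)) • tmul C ρ 1 v := by
      rw [reduction_tmul, map_smul, sub_smul, incl_apply, ← tmul_eq_smul, algebraMap_smul]
    rw [h]
    refine Submodule.smul_mem_smul ?_ trivial
    rw [RingHom.mem_ker, map_sub, AlgHom.commutes, Algebra.algebraMap_self_apply, sub_self]
  | hadd x y hx hy =>
    have h : x + y - incl C ρ (reduction ε ρ (x + y)) =
        (x - incl C ρ (reduction ε ρ x)) + (y - incl C ρ (reduction ε ρ y)) := by
      rw [map_add, map_add]
      abel
    rw [h]
    exact add_mem hx hy

theorem mem_ker_smul_top_of_reduction_eq_zero {x : TwistedTensor C ρ} (hx : reduction ε ρ x = 0) :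
    x ∈ RingHom.ker ε • (⊤ : Submodule C (TwistedTensor C ρ)) := by
  simpa [hx] using sub_incl_reduction_mem ε x

theorem reduction_eq_of_linear (ψ : TwistedTensor C ρ →ₗ[SkewMonoidAlgebra C G] TwistedTensor C ρ')
    (x : TwistedTensor C ρ) :
    reduction ε ρ' (ψ x) = reduction ε ρ' (ψ (incl C ρ (reduction ε ρ x))) := by
  induction x using TwistedTensor.induction_on with
  | h c v =>
    have h : incl C ρ (reduction ε ρ (tmul C ρ c v)) = algebraMap k C (ε c) • tmul C ρ 1 v := by
      rw [reduction_tmul, map_smul, incl_apply, algebraMap_smul]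
    rw [h, tmul_eq_smul, map_smul_of_linear, reduction_smul, map_smul_of_linear, reduction_smul,
      AlgHom.commutes, Algebra.algebraMap_self_apply]
  | hadd x y hx hy => rw [map_add, map_add, hx, hy, map_add, map_add, map_add, map_add]

theorem existsUnique_reduction (hε : ∀ (g : G) c, ε (g • c) = ε c)
    (ψ : TwistedTensor C ρ →ₗ[SkewMonoidAlgebra C G] TwistedTensor C ρ') :
    ∃! f : ρ.asModule →ₗ[MonoidAlgebra k G] ρ'.asModule,
      ∀ x, f (reductionHom ε ρ x) = reductionHom ε ρ' (ψ x) := by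
  let h : V →ₗ[k] V' := reduction ε ρ' ∘ₗ ((toLinearMap ψ).restrictScalars k) ∘ₗ incl C ρ
  have hh : ∀ g v, h (ρ g v) = ρ' g (h v) := by
    intro g v
    change reduction ε ρ' (ψ (incl C ρ (ρ g v))) = ρ' g (reduction ε ρ' (ψ (incl C ρ v)))
    rw [← reduction_diag ε hε, ← map_diag_of_linear, incl_apply, incl_apply, diag_tmul', smul_one]
  refine ⟨Representation.asModuleHomOfEquivariant h hh, fun x => ?_, fun f hf => ?_⟩
  · exact (reduction_eq_of_linear ε ψ x).symm
  · refine LinearMap.ext fun v => ?_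
    have h1 := hf (inclHom C ρ v)
    rwa [reductionHom_inclHom] at h1

theorem repr_mem_of_mem_smul_top {J : Ideal C} {x : TwistedTensor C ρ}
    (hx : x ∈ J • (⊤ : Submodule C (TwistedTensor C ρ))) (i) : (basis C ρ).repr x i ∈ J := by
  refine Submodule.smul_induction_on hx (fun c hc y _ => ?_) fun y z hy hz => ?_
  · rw [map_smul, Finsupp.smul_apply, smul_eq_mul]
    exact Ideal.mul_mem_right _ _ hc
  · rw [map_add, Finsupp.add_apply]
    exact add_mem hy hz

/-- In a free module the intersection of the submodules `J n • ⊤` vanishes if that of the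
ideals `J n` does. -/
theorem eq_zero_of_forall_mem_smul_top {ι : Type*} (J : ι → Ideal C) (hJ : ⨅ n, J n = ⊥)
    {x : TwistedTensor C ρ} (hx : ∀ n, x ∈ J n • (⊤ : Submodule C (TwistedTensor C ρ))) : x = 0 := by
  refine (basis C ρ).ext_elem fun i => ?_
  rw [map_zero, Finsupp.zero_apply, ← Ideal.mem_bot, ← hJ, Ideal.mem_iInf]
  exact fun n => repr_mem_of_mem_smul_top (hx n) i

theorem eq_zero_of_isIdempotentElem_of_reduction_eq_zero (hsep : ⨅ n : ℕ, RingHom.ker ε ^ n = ⊥)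
    (e : Module.End (SkewMonoidAlgebra C G) (TwistedTensor C ρ)) (he : IsIdempotentElem e)
    (h0 : ∀ x, reduction ε ρ (e x) = 0) : e = 0 := by
  have he' : ∀ x, e (e x) = e x := fun x => LinearMap.congr_fun he x
  have key : ∀ n : ℕ, ∀ x, e x ∈ RingHom.ker ε ^ n • (⊤ : Submodule C (TwistedTensor C ρ)) := by
    intro n
    induction n with
    | zero => simp
    | succ n ih =>
      intro x
      have h1 := Submodule.mem_map_of_mem (f := toLinearMap e) (ih x)
      rw [toLinearMap_apply, he', Submodule.map_smul''] at h1
      rw [pow_succ, Submodule.mul_smul]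
      refine Submodule.smul_mono le_rfl ?_ h1
      rintro _ ⟨y, -, rfl⟩
      exact mem_ker_smul_top_of_reduction_eq_zero ε (h0 y)
  exact LinearMap.ext fun x => eq_zero_of_forall_mem_smul_top _ hsep fun n => key n x

theorem isIndecomposableModule_iff_asModule (hε : ∀ (g : G) c, ε (g • c) = ε c)
    (hsep : ⨅ n : ℕ, RingHom.ker ε ^ n = ⊥) :
    IsIndecomposableModule (MonoidAlgebra k G) ρ.asModule ↔
      IsIndecomposableModule (SkewMonoidAlgebra C G) (TwistedTensor C ρ) := by
  constructor
  · refine IsIndecomposableModule.of_ringHom (Module.End.ringHomOfExistsUnique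
      (reductionHom ε ρ)
      (existsUnique_reduction ε hε)) fun e he h0 => ?_
    refine eq_zero_of_isIdempotentElem_of_reduction_eq_zero ε hsep e he fun x => ?_
    have h := Module.End.ringHomOfExistsUnique_apply
      (reductionHom ε ρ)
      (existsUnique_reduction ε hε) e x
    rw [h0] at h
    exact h.symm
  · exact IsIndecomposableModule.of_injective_ringHom _
      (Module.End.ringHomOfExistsUnique_injective
        (inclHom C ρ)
        existsUnique_of_asModuleHom (inclHom_injective ε))

theorem nonempty_linearEquiv_iff_asModule (hε : ∀ (g : G) c, ε (g • c) = ε c) :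
    Nonempty (ρ.asModule ≃ₗ[MonoidAlgebra k G] ρ'.asModule) ↔
      Nonempty (TwistedTensor C ρ ≃ₗ[SkewMonoidAlgebra C G] TwistedTensor C ρ') := by
  constructor
  · exact nonempty_linearEquiv_of_existsUnique
      (inclHom C ρ)
      (inclHom C ρ')
      (fun f => (existsUnique_of_asModuleHom f).exists)
      (fun f => (existsUnique_of_asModuleHom f).exists)
      (fun _ _ h => hom_ext h) (fun _ _ h => hom_ext h)
  · refine nonempty_linearEquiv_of_existsUnique
      (reductionHom ε ρ)
      (reductionHom ε ρ')
      (fun f => (existsUnique_reduction ε hε f).exists)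
      (fun f => (existsUnique_reduction ε hε f).exists)
      (fun f f' h => LinearMap.ext fun v => ?_) (fun f f' h => LinearMap.ext fun v => ?_)
    · have h1 := h (inclHom C ρ v)
      rwa [reductionHom_inclHom] at h1
    · have h1 := h (inclHom C ρ' v)
      rwa [reductionHom_inclHom] at h1

end Augmentation

end TwistedTensor

namespace TwistedTensor

variable {k G V V' B C : Type*} [Field k] [Group G] [AddCommGroup V] [Module k V]
  [AddCommGroup V'] [Module k V']
  [CommRing B] [Algebra k B] [MulSemiringAction G B] [SMulCommClass G k B]
  [CommRing C] [Algebra k C] [MulSemiringAction G C] [SMulCommClass G k C]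
  [Algebra B C] [IsScalarTower k B C]
  {ρ : Representation k G V} {ρ' : Representation k G V'}

section Regular

variable [FiniteDimensional k V]

theorem eq_zero_of_smul_eq_zero {s : C} (hs : ∀ c : C, s * c = 0 → c = 0)
    (x : TwistedTensor C ρ) (hx : s • x = 0) : x = 0 := by
  refine (basis C ρ).ext_elem fun i => ?_
  rw [map_zero, Finsupp.zero_apply]
  refine hs _ ?_
  rw [← smul_eq_mul, ← Finsupp.smul_apply, ← map_smul, hx, map_zero, Finsupp.zero_apply]

theorem exists_eq_smul_of_smul_eq_smul {s t : C} (hst : ∀ c c' : C, t * c = s * c' → s ∣ c)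
    (x y : TwistedTensor C ρ) (hx : t • x = s • y) : ∃ z, x = s • z := by
  have h : ∀ i, ∃ d, (basis C ρ).repr x i = s * d := fun i => hst _ ((basis C ρ).repr y i) (by
    rw [← smul_eq_mul, ← smul_eq_mul, ← Finsupp.smul_apply, ← Finsupp.smul_apply, ← map_smul,
      ← map_smul, hx])
  choose d hd using h
  refine ⟨∑ i, d i • basis C ρ i, ?_⟩
  rw [Finset.smul_sum, ← (basis C ρ).sum_repr x]
  exact Finset.sum_congr rfl fun i _ => by rw [hd, mul_smul]

end Regular

section ExtendScalars

variable (C ρ) in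
/-- The canonical map `B ⊗ V → C ⊗ V` for a `B`-algebra `C`. -/
noncomputable def extendScalars : TwistedTensor B ρ →ₗ[k] TwistedTensor C ρ :=
  LinearMap.rTensor V (IsScalarTower.toAlgHom k B C).toLinearMap

theorem extendScalars_tmul (b : B) (v : V) :
    extendScalars C ρ (tmul B ρ b v) = tmul C ρ (algebraMap B C b) v := rfl

theorem extendScalars_smul (b : B) (x : TwistedTensor B ρ) :
    extendScalars C ρ (b • x) = algebraMap B C b • extendScalars C ρ x := by
  induction x using TwistedTensor.induction_on with
  | h c v => rw [smul_tmul', extendScalars_tmul, extendScalars_tmul, smul_tmul', map_mul]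
  | hadd x y hx hy => rw [smul_add, map_add, hx, hy, map_add, smul_add]

theorem extendScalars_diag (hBC : ∀ (g : G) b, g • algebraMap B C b = algebraMap B C (g • b))
    (g : G) (x : TwistedTensor B ρ) :
    extendScalars C ρ (diag B ρ g x) = diag C ρ g (extendScalars C ρ x) := by
  induction x using TwistedTensor.induction_on with
  | h c v => rw [diag_tmul', extendScalars_tmul, extendScalars_tmul, diag_tmul', hBC]
  | hadd x y hx hy => simp only [map_add, hx, hy]

theorem extendScalars_self (x : TwistedTensor B ρ) : extendScalars B ρ x = x := by
  induction x using TwistedTensor.induction_on with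
  | h c v => rfl
  | hadd x y hx hy => rw [map_add, hx, hy]

end ExtendScalars

section Extension

variable [Finite G] [FiniteDimensional k V']
  {s t : B} (hs : s ∈ freenessIdeal G B) (ht : t ∈ freenessIdeal G B)
  (hs0 : ∀ c : C, algebraMap B C s * c = 0 → c = 0)
  (hst : ∀ c c' : C, algebraMap B C t * c = algebraMap B C s * c' → algebraMap B C s ∣ c)
  (hBC : ∀ (g : G) b, g • algebraMap B C b = algebraMap B C (g • b))

include hs hs0 in
theorem hom_eq_of_eqOn_invariants
    {ψ ψ' : TwistedTensor C ρ →ₗ[SkewMonoidAlgebra C G] TwistedTensor C ρ'}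
    (h : ∀ x : TwistedTensor B ρ, x ∈ invariants B ρ → ψ (extendScalars C ρ x) = ψ' (extendScalars C ρ x)) : ψ = ψ' := by
  let _ : Module B (TwistedTensor C ρ') := Module.compHom _ (algebraMap B C)
  let res : (TwistedTensor C ρ →ₗ[SkewMonoidAlgebra C G] TwistedTensor C ρ') →
      TwistedTensor B ρ →ₗ[B] TwistedTensor C ρ' := fun ψ =>
    { toFun := fun x => ψ (extendScalars C ρ x)
      map_add' := fun x y => by rw [map_add, map_add]
      map_smul' := fun b x => by
        rw [extendScalars_smul, map_smul_of_linear]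
        rfl }
  have hres : res ψ = res ψ' :=
    linearMap_eq_of_eqOn_invariants (σ := diag B ρ) (invariants B ρ) (fun _ => Iff.rfl)
      (diag_smul B ρ) hs (fun n hn => eq_zero_of_smul_eq_zero hs0 n hn) _ _ h
  refine hom_ext fun v => ?_
  have h1 := LinearMap.congr_fun hres (tmul B ρ 1 v)
  change ψ (extendScalars C ρ (tmul B ρ 1 v)) = ψ' (extendScalars C ρ (tmul B ρ 1 v)) at h1
  rwa [extendScalars_tmul, map_one] at h1

include hs ht hs0 hst hBC in
theorem existsUnique_extension (φ : invariants B ρ → TwistedTensor C ρ')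
    (hadd : ∀ x y, φ (x + y) = φ x + φ y)
    (hsmul : ∀ (a : FixedPoints.subalgebra k B G) x, φ (a • x) = algebraMap B C a • φ x)
    (hφ : ∀ x g, diag C ρ' g (φ x) = φ x) :
    ∃! ψ : TwistedTensor C ρ →ₗ[SkewMonoidAlgebra C G] TwistedTensor C ρ',
      ∀ x : invariants B ρ, ψ (extendScalars C ρ (x : TwistedTensor B ρ)) = φ x := by
  let _ : Module B (TwistedTensor C ρ') := Module.compHom _ (algebraMap B C)
  have hB : ∀ (b : B) (n : TwistedTensor C ρ'), b • n = algebraMap B C b • n := fun _ _ => rfl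
  obtain ⟨ψ₀, hψ₀, hdiag⟩ := exists_equivariant_extension (σ := diag B ρ) (σ' := diag C ρ')
    (invariants B ρ) (fun _ => Iff.rfl) (diag_smul B ρ)
    (fun g b x => by rw [hB, hB, diag_smul, hBC]) hs ht
    (fun n hn => eq_zero_of_smul_eq_zero hs0 n hn)
    (fun n n' hn => exists_eq_smul_of_smul_eq_smul hst n n' hn) φ hadd hsmul hφ
  let l : V →ₗ[k] TwistedTensor C ρ' :=
    { toFun := fun v => ψ₀ (incl B ρ v)
      map_add' := fun x y => by rw [map_add, map_add]
      map_smul' := fun c v => by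
        rw [map_smul, ← algebraMap_smul B, map_smul, hB, ← IsScalarTower.algebraMap_apply,
          algebraMap_smul, RingHom.id_apply] }
  let ψ₁ : TwistedTensor C ρ →ₗ[C] TwistedTensor C ρ' := LinearMap.liftBaseChange C l
  have hψ₁ : ∀ c v, ψ₁ (tmul C ρ c v) = c • ψ₀ (tmul B ρ 1 v) := fun c v =>
    LinearMap.liftBaseChange_tmul C l c v
  have hψ₁' : ∀ x, ψ₁ (extendScalars C ρ x) = ψ₀ x := by
    intro x
    induction x using TwistedTensor.induction_on with
    | h b v => rw [extendScalars_tmul, hψ₁, ← hB, ← map_smul, ← tmul_eq_smul]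
    | hadd x y hx hy => rw [map_add, map_add, hx, hy, map_add]
  refine ⟨ofEquivariant ψ₁ fun g x => ?_, fun x => ?_, fun ψ hψ => ?_⟩
  · induction x using TwistedTensor.induction_on with
    | h c v =>
      rw [diag_tmul', hψ₁, hψ₁, diag_smul, ← hdiag, diag_tmul', smul_one]
    | hadd x y hx hy => simp only [map_add, hx, hy]
  · rw [ofEquivariant_apply, hψ₁', hψ₀]
  · refine hom_eq_of_eqOn_invariants hs hs0 fun x hx => ?_
    rw [hψ ⟨x, hx⟩, ofEquivariant_apply, hψ₁', ← hψ₀ ⟨x, hx⟩]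

end Extension

section Invariants

theorem baseChange_id (x : TwistedTensor B ρ) :
    (baseChange LinearMap.id : TwistedTensor B ρ →ₗ[B] TwistedTensor B ρ) x = x := by
  induction x using TwistedTensor.induction_on with
  | h c v => rfl
  | hadd x y hx hy => rw [map_add, hx, hy]

theorem baseChange_baseChange (h : V' →ₗ[k] V) (h' : V →ₗ[k] V') (x : TwistedTensor B ρ) :
    (baseChange h : TwistedTensor B ρ' →ₗ[B] TwistedTensor B ρ)
        ((baseChange h' : TwistedTensor B ρ →ₗ[B] TwistedTensor B ρ') x) =
      (baseChange (h ∘ₗ h') : TwistedTensor B ρ →ₗ[B] TwistedTensor B ρ) x := by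
  induction x using TwistedTensor.induction_on with
  | h c v => rfl
  | hadd x y hx hy => simp only [map_add, hx, hy]

theorem baseChange_mem_invariants (f : ρ.asModule →ₗ[MonoidAlgebra k G] ρ'.asModule)
    {x : TwistedTensor B ρ} (hx : x ∈ invariants B ρ) :
    (baseChange (Representation.asModuleHomToLinearMap f) : TwistedTensor B ρ →ₗ[B]
      TwistedTensor B ρ') x ∈ invariants B ρ' := fun g => by
  rw [← baseChange_diag _ (Representation.asModuleHomToLinearMap_rho f), hx g]

variable (B) in
/-- The map of modules of invariants induced by a map of `kG`-modules. -/
noncomputable def invariantsMap (f : ρ.asModule →ₗ[MonoidAlgebra k G] ρ'.asModule) :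
    invariants B ρ →ₗ[FixedPoints.subalgebra k B G] invariants B ρ' where
  toFun x := ⟨_, baseChange_mem_invariants f x.2⟩
  map_add' _ _ := Subtype.ext (map_add (baseChange _) _ _)
  map_smul' a x := Subtype.ext (map_smul (baseChange _) (a : B) (x : TwistedTensor B ρ))

theorem coe_invariantsMap (f : ρ.asModule →ₗ[MonoidAlgebra k G] ρ'.asModule) (x : invariants B ρ) :
    (invariantsMap B f x : TwistedTensor B ρ') =
      (baseChange (Representation.asModuleHomToLinearMap f) : TwistedTensor B ρ →ₗ[B]
        TwistedTensor B ρ') x := rfl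

theorem invariantsMap_symm_apply (f : ρ.asModule ≃ₗ[MonoidAlgebra k G] ρ'.asModule)
    (x : invariants B ρ) :
    invariantsMap B f.symm.toLinearMap (invariantsMap B f.toLinearMap x) = x := by
  apply Subtype.ext
  rw [coe_invariantsMap, coe_invariantsMap, baseChange_baseChange]
  have h : Representation.asModuleHomToLinearMap f.symm.toLinearMap ∘ₗ
      Representation.asModuleHomToLinearMap f.toLinearMap = LinearMap.id :=
    LinearMap.ext fun v => f.symm_apply_apply v
  rw [h, baseChange_id]

variable (B) in
/-- The isomorphism of modules of invariants induced by an isomorphism of `kG`-modules. -/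
noncomputable def invariantsCongr (f : ρ.asModule ≃ₗ[MonoidAlgebra k G] ρ'.asModule) :
    invariants B ρ ≃ₗ[FixedPoints.subalgebra k B G] invariants B ρ' :=
  LinearEquiv.ofLinearMap (invariantsMap B f.toLinearMap) (invariantsMap B f.symm.toLinearMap)
    (LinearMap.ext (invariantsMap_symm_apply f.symm)) (LinearMap.ext (invariantsMap_symm_apply f))

end Invariants

end TwistedTensor

section InvariantRing

variable {k B G : Type*} [Field k] [CommRing B] [Algebra k B] [Group G] [Finite G]
  [MulSemiringAction G B] [SMulCommClass G k B]

theorem isInvariant_fixedPoints : Algebra.IsInvariant (FixedPoints.subalgebra k B G) B G where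
  isInvariant b hb := ⟨⟨b, hb⟩, rfl⟩

theorem finite_over_fixedPoints [Algebra.FiniteType k B] :
    Module.Finite (FixedPoints.subalgebra k B G) B := by
  have := isInvariant_fixedPoints (k := k) (B := B) (G := G)
  have : Algebra.IsIntegral (FixedPoints.subalgebra k B G) B := Algebra.IsInvariant.isIntegral _ _ G
  have : Algebra.FiniteType (FixedPoints.subalgebra k B G) B := .of_restrictScalars_finiteType k _ _
  exact Algebra.IsIntegral.finite

theorem isNoetherianRing_fixedPoints [Algebra.FiniteType k B] :
    IsNoetherianRing (FixedPoints.subalgebra k B G) := by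
  have := finite_over_fixedPoints (k := k) (B := B) (G := G)
  have : Algebra.FiniteType k (FixedPoints.subalgebra k B G) :=
    ⟨fg_of_fg_of_fg k _ B Algebra.FiniteType.out Module.Finite.fg_top Subtype.val_injective⟩
  exact Algebra.FiniteType.isNoetherianRing k _

/-- A stable ideal is contained in the radical of the extension of its contraction to the ring of
invariants. -/
theorem le_radical_map_comap_fixedPoints (I : Ideal B) [IsStableIdeal G I] :
    I ≤ ((I.comap (algebraMap (FixedPoints.subalgebra k B G) B)).map
      (algebraMap (FixedPoints.subalgebra k B G) B)).radical := by
  classical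
  have := Fintype.ofFinite G
  intro b hb
  set p := MulSemiringAction.charpoly G b with hp
  have hmap : p.map (Ideal.Quotient.mk I) = Polynomial.X ^ Fintype.card G := by
    rw [hp, MulSemiringAction.charpoly_eq, Polynomial.map_prod, Finset.prod_congr rfl, Finset.prod_const,
      Finset.card_univ]
    intro g _
    rw [Polynomial.map_sub, Polynomial.map_X, Polynomial.map_C,
      Ideal.Quotient.eq_zero_iff_mem.mpr (IsStableIdeal.smul_mem g b hb), Polynomial.C_0, sub_zero]
  have hcoeff : ∀ i ≠ Fintype.card G, p.coeff i ∈
      (I.comap (algebraMap (FixedPoints.subalgebra k B G) B)).map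
        (algebraMap (FixedPoints.subalgebra k B G) B) := by
    intro i hi
    have h1 : p.coeff i ∈ I := by
      rw [← Ideal.Quotient.eq_zero_iff_mem, ← Polynomial.coeff_map, hmap, Polynomial.coeff_X_pow,
        if_neg hi]
    let a : FixedPoints.subalgebra k B G := ⟨p.coeff i, MulSemiringAction.smul_coeff_charpoly b i⟩
    have ha : a ∈ I.comap (algebraMap (FixedPoints.subalgebra k B G) B) := h1
    exact Ideal.mem_map_of_mem (algebraMap (FixedPoints.subalgebra k B G) B) ha
  by_cases hI : I = ⊤
  · subst hI
    rw [Ideal.comap_top, Ideal.map_top, Ideal.radical_top]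
    trivial
  have : Nontrivial (B ⧸ I) := Ideal.Quotient.nontrivial_iff.mpr hI
  have : Nontrivial B := (Ideal.Quotient.mk I).domain_nontrivial
  have hmonic : p.Monic := MulSemiringAction.monic_charpoly G b
  have hdeg : p.natDegree = Fintype.card G := by
    rw [← hmonic.natDegree_map (Ideal.Quotient.mk I), hmap, Polynomial.natDegree_X_pow]
  refine ⟨Fintype.card G, ?_⟩
  have heval := MulSemiringAction.eval_charpoly G b
  rw [← hp, Polynomial.eval_eq_sum_range, Finset.sum_range_succ, hmonic.coeff_natDegree, one_mul,
    hdeg] at heval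
  rw [eq_neg_iff_add_eq_zero.mpr ((add_comm _ _).trans heval), neg_mem_iff]
  exact sum_mem fun i hi => Ideal.mul_mem_right _ _ (hcoeff i (Finset.mem_range.mp hi).ne)

theorem exists_pow_le_map_comap_fixedPoints [IsNoetherianRing B] (I : Ideal B) [IsStableIdeal G I] :
    ∃ N : ℕ, I ^ N ≤ (I.comap (algebraMap (FixedPoints.subalgebra k B G) B)).map
      (algebraMap (FixedPoints.subalgebra k B G) B) :=
  Ideal.exists_pow_le_of_le_radical_of_fg (le_radical_map_comap_fixedPoints I)
    (IsNoetherian.noetherian I)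

end InvariantRing

section Augmentation

variable {k C : Type*} [Field k] [CommRing C] [Algebra k C]

/-- An ideal complementary to the ground field is the kernel of an augmentation. -/
theorem exists_augmentation (G : Type*) [Group G] [MulSemiringAction G C] [SMulCommClass G k C]
    (J : Ideal C) [IsStableIdeal G J] (h1 : J ≠ ⊤)
    (hJ : ∀ x : C, ∃ c : k, x - algebraMap k C c ∈ J) :
    ∃ ε : C →ₐ[k] k, RingHom.ker ε = J ∧ ∀ (g : G) x, ε (g • x) = ε x := by
  have : Nontrivial (C ⧸ J) := Ideal.Quotient.nontrivial_iff.mpr h1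
  have hbij : Function.Bijective (Algebra.ofId k (C ⧸ J)) := by
    refine ⟨(Algebra.ofId k (C ⧸ J)).toRingHom.injective, fun y => ?_⟩
    obtain ⟨x, rfl⟩ := Ideal.Quotient.mk_surjective y
    obtain ⟨c, hc⟩ := hJ x
    exact ⟨c, (Ideal.Quotient.eq.mpr hc).symm⟩
  let e := AlgEquiv.ofBijective _ hbij
  let ε : C →ₐ[k] k := (e.symm : (C ⧸ J) →ₐ[k] k).comp (Ideal.Quotient.mkₐ k J)
  have hker : RingHom.ker ε = J := by
    ext x
    rw [RingHom.mem_ker]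
    change e.symm (Ideal.Quotient.mk J x) = 0 ↔ _
    rw [map_eq_zero_iff _ e.symm.injective, Ideal.Quotient.eq_zero_iff_mem]
  refine ⟨ε, hker, fun g x => ?_⟩
  have key : ∀ y c, y - algebraMap k C c ∈ J → ε y = c := by
    intro y c hy
    rw [← hker, RingHom.mem_ker, map_sub, AlgHom.commutes, sub_eq_zero] at hy
    exact hy
  obtain ⟨c, hc⟩ := hJ x
  rw [key x c hc]
  refine key _ c ?_
  have h := IsStableIdeal.smul_mem g _ hc
  rwa [smul_sub, smul_algebraMap] at h

end Augmentation

section Flat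

variable {B C : Type*} [CommRing B] [IsDomain B] [DecompositionMonoid B] [CommRing C] [Algebra B C]
  [Module.Flat B C]

theorem isWeaklyRegular_pair_of_isRelPrime {s t : B} (hs : s ≠ 0) (h : IsRelPrime s t) :
    RingTheory.Sequence.IsWeaklyRegular B [s, t] := by
  rw [RingTheory.Sequence.isWeaklyRegular_cons_iff, RingTheory.Sequence.isWeaklyRegular_singleton_iff]
  refine ⟨(IsRegular.of_ne_zero hs).left, ?_⟩
  rw [isSMulRegular_iff_right_eq_zero_of_smul]
  intro x hx
  obtain ⟨b, rfl⟩ := Submodule.Quotient.mk_surjective _ x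
  rw [← Submodule.Quotient.mk_smul, Submodule.Quotient.mk_eq_zero,
    Submodule.mem_smul_pointwise_iff_exists] at hx
  obtain ⟨c, -, hc⟩ := hx
  obtain ⟨d, rfl⟩ := h.dvd_of_dvd_mul_left (Dvd.intro c hc)
  rw [Submodule.Quotient.mk_eq_zero]
  exact Submodule.smul_mem_pointwise_smul d s ⊤ trivial

theorem isWeaklyRegular_pair_algebraMap {s t : B} (hs : s ≠ 0) (h : IsRelPrime s t) :
    RingTheory.Sequence.IsWeaklyRegular C [algebraMap B C s, algebraMap B C t] :=
  (isWeaklyRegular_pair_of_isRelPrime hs h).of_flat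

theorem eq_zero_of_algebraMap_mul_eq_zero {s t : B} (hs : s ≠ 0) (h : IsRelPrime s t) (c : C)
    (hc : algebraMap B C s * c = 0) : c = 0 := by
  have := isWeaklyRegular_pair_algebraMap (C := C) hs h
  rw [RingTheory.Sequence.isWeaklyRegular_cons_iff] at this
  exact this.1.right_eq_zero_of_smul hc

theorem dvd_of_algebraMap_mul_eq_mul {s t : B} (hs : s ≠ 0) (h : IsRelPrime s t) (c c' : C)
    (hc : algebraMap B C t * c = algebraMap B C s * c') : algebraMap B C s ∣ c := by
  have := isWeaklyRegular_pair_algebraMap (C := C) hs h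
  rw [RingTheory.Sequence.isWeaklyRegular_cons_iff,
    RingTheory.Sequence.isWeaklyRegular_singleton_iff] at this
  have h0 : (Submodule.Quotient.mk c : QuotSMulTop (algebraMap B C s) C) = 0 := by
    refine this.2.right_eq_zero_of_smul ?_
    rw [← Submodule.Quotient.mk_smul, smul_eq_mul, hc, Submodule.Quotient.mk_eq_zero]
    exact Submodule.smul_mem_pointwise_smul c' _ ⊤ trivial
  rw [Submodule.Quotient.mk_eq_zero, Submodule.mem_smul_pointwise_iff_exists] at h0
  obtain ⟨d, -, hd⟩ := h0
  exact ⟨d, hd.symm⟩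

end Flat

namespace AdicCompletion

variable {R M M' : Type*} [CommRing R] {J : Ideal R} [AddCommGroup M] [Module R M]
  [AddCommGroup M'] [Module R M']

theorem map_smul_of_linear (f : AdicCompletion J M →ₗ[AdicCompletion J R] AdicCompletion J M')
    (a : R) (x : AdicCompletion J M) : f (a • x) = a • f x :=
  (f.restrictScalars R).map_smul a x

theorem sub_of_mem_pow_smul_top (hJ : J.FG) {n : ℕ} {x : AdicCompletion J M} {z : M}
    (h : eval J M n x = Submodule.Quotient.mk z) :
    x - of J M z ∈ J ^ n • (⊤ : Submodule R (AdicCompletion J M)) := by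
  rw [pow_smul_top_eq_ker_eval hJ, LinearMap.mem_ker, map_sub, h]
  exact sub_self _

end AdicCompletion

section CompletionIdeal

variable {B : Type*} [CommRing B] (I : Ideal B)

/-- The kernel of the projection of the `I`-adic completion to `B ⧸ I ^ n`. -/
noncomputable def completionIdeal (n : ℕ) : Ideal (AdicCompletion I B) :=
  RingHom.ker (AdicCompletion.evalₐ I n)

variable {I}

theorem mem_completionIdeal {n : ℕ} {x : AdicCompletion I B} :
    x ∈ completionIdeal I n ↔ AdicCompletion.evalₐ I n x = 0 := Iff.rfl

theorem algebraMap_mem_completionIdeal {n : ℕ} {b : B} :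
    algebraMap B (AdicCompletion I B) b ∈ completionIdeal I n ↔ b ∈ I ^ n := by
  rw [mem_completionIdeal, AdicCompletion.algebraMap_apply, AdicCompletion.evalₐ_of,
    Ideal.Quotient.eq_zero_iff_mem, Algebra.algebraMap_self_apply]

variable (I) in
theorem iInf_completionIdeal : ⨅ n, completionIdeal I n = ⊥ := by
  rw [eq_bot_iff]
  intro x hx
  rw [Ideal.mem_iInf] at hx
  refine AdicCompletion.ext_evalₐ fun n => ?_
  rw [map_zero]
  exact hx n

variable (I) in
theorem completionIdeal_one_pow_le (n : ℕ) : completionIdeal I 1 ^ n ≤ completionIdeal I n := by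
  rcases Nat.eq_zero_or_pos n with rfl | hn
  · intro x _
    obtain ⟨b, hb⟩ := Ideal.Quotient.mk_surjective (AdicCompletion.evalₐ I 0 x)
    rw [mem_completionIdeal, ← hb, Ideal.Quotient.eq_zero_iff_mem, pow_zero, Ideal.one_eq_top]
    trivial
  have h : completionIdeal I 1 ≤
      (I.map (Ideal.Quotient.mk (I ^ n))).comap (AdicCompletion.evalₐ I n) := by
    intro x hx
    obtain ⟨b, hb⟩ := Ideal.Quotient.mk_surjective (AdicCompletion.evalₐ I n x)
    rw [mem_completionIdeal, ← factorPow_evalₐ I hn, ← hb] at hx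
    have hb' : b ∈ I := by
      have : b ∈ I ^ 1 := Ideal.Quotient.eq_zero_iff_mem.mp hx
      rwa [pow_one] at this
    rw [Ideal.mem_comap, ← hb]
    exact Ideal.mem_map_of_mem _ hb'
  refine (Ideal.pow_right_mono h n).trans ((Ideal.le_comap_pow _ n).trans ?_)
  rw [← Ideal.map_pow, Ideal.map_quotient_self]
  exact fun x hx => hx

instance isStableIdeal_completionIdeal (G : Type*) [Group G] [MulSemiringAction G B]
    [IsStableIdeal G I] (n : ℕ) : IsStableIdeal G (completionIdeal I n) where
  smul_mem g x hx := by
    rw [mem_completionIdeal] at hx ⊢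
    exact (evalₐ_completionSMul G I g n x).trans (by rw [hx, map_zero])

theorem smul_algebraMap_completion {G : Type*} [Group G] [MulSemiringAction G B]
    [IsStableIdeal G I] (g : G) (b : B) :
    g • algebraMap B (AdicCompletion I B) b = algebraMap B (AdicCompletion I B) (g • b) :=
  completion_smul_of G I g b

/-- An augmentation of `B` with kernel `I` extends to the `I`-adic completion. -/
theorem exists_augmentation_completion {k : Type*} [Field k] [Algebra k B] (G : Type*) [Group G]
    [MulSemiringAction G B] [SMulCommClass G k B] [IsStableIdeal G I] (h1 : I ≠ ⊤)
    (hI : ∀ x : B, ∃ c : k, x - algebraMap k B c ∈ I) :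
    ∃ ε : AdicCompletion I B →ₐ[k] k, ⨅ n : ℕ, RingHom.ker ε ^ n = ⊥ ∧
      ∀ (g : G) x, ε (g • x) = ε x := by
  have h2 : completionIdeal I 1 ≠ ⊤ := by
    intro h
    rw [Ideal.ne_top_iff_one, ← pow_one I, ← algebraMap_mem_completionIdeal, h] at h1
    exact h1 trivial
  have h3 : ∀ x : AdicCompletion I B, ∃ c : k,
      x - algebraMap k (AdicCompletion I B) c ∈ completionIdeal I 1 := by
    intro x
    obtain ⟨b, hb⟩ := Ideal.Quotient.mk_surjective (AdicCompletion.evalₐ I 1 x)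
    obtain ⟨c, hc⟩ := hI b
    refine ⟨c, ?_⟩
    have h2 : AdicCompletion.evalₐ I 1 (algebraMap k (AdicCompletion I B) c) =
        Ideal.Quotient.mk (I ^ 1) (algebraMap k B c) := by
      rw [AdicCompletion.algebraMap_apply, AdicCompletion.evalₐ_of]
    rw [mem_completionIdeal, map_sub, h2, ← hb, ← map_sub, Ideal.Quotient.eq_zero_iff_mem, pow_one]
    exact hc
  obtain ⟨ε, hker, hε⟩ := exists_augmentation (k := k) G (completionIdeal I 1) h2 h3
  refine ⟨ε, ?_, hε⟩
  rw [hker, eq_bot_iff, ← iInf_completionIdeal I]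
  exact iInf_mono (completionIdeal_one_pow_le I)

end CompletionIdeal

namespace TwistedTensor

variable {k G V V' B : Type*} [Field k] [Group G] [AddCommGroup V] [Module k V]
  [AddCommGroup V'] [Module k V']
  [CommRing B] [Algebra k B] [MulSemiringAction G B] [SMulCommClass G k B]
  {ρ : Representation k G V} {ρ' : Representation k G V'}
  (I : Ideal B) [IsStableIdeal G I]

local notation "𝔸" => FixedPoints.subalgebra k B G
local notation "𝔞" => Ideal.comap (algebraMap (FixedPoints.subalgebra k B G) B) I
local notation "Bc" => AdicCompletion I B

theorem coe_mem_pow_of_mem_comap_pow {n : ℕ} {a : 𝔸} (ha : a ∈ 𝔞 ^ n) : (a : B) ∈ I ^ n :=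
  Ideal.le_comap_pow (algebraMap 𝔸 B) n ha

theorem repr_extendScalars {C : Type*} [CommRing C] [Algebra k C] [MulSemiringAction G C]
    [SMulCommClass G k C] [Algebra B C] [IsScalarTower k B C] (x : TwistedTensor B ρ) (i) :
    (basis C ρ).repr (extendScalars C ρ x) i = algebraMap B C ((basis B ρ).repr x i) := by
  induction x using TwistedTensor.induction_on with
  | h b v =>
    rw [extendScalars_tmul]
    change ((Module.Basis.ofVectorSpace k V).baseChange C).repr (algebraMap B C b ⊗ₜ[k] v) i =
      algebraMap B C (((Module.Basis.ofVectorSpace k V).baseChange B).repr (b ⊗ₜ[k] v) i)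
    rw [Module.Basis.baseChange_repr_tmul, Module.Basis.baseChange_repr_tmul, Algebra.smul_def,
      Algebra.smul_def, map_mul, ← IsScalarTower.algebraMap_apply]
  | hadd x y hx hy => simp only [map_add, Finsupp.add_apply, hx, hy]

theorem repr_mem_pow_of_mem_smul_top {n : ℕ} {x : invariants B ρ}
    (hx : x ∈ 𝔞 ^ n • (⊤ : Submodule 𝔸 (invariants B ρ))) (i) :
    (basis B ρ).repr (x : TwistedTensor B ρ) i ∈ I ^ n := by
  refine Submodule.smul_induction_on hx (fun a ha y _ => ?_) fun y z hy hz => ?_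
  · change (basis B ρ).repr ((a : B) • (y : TwistedTensor B ρ)) i ∈ _
    rw [map_smul, Finsupp.smul_apply, smul_eq_mul]
    exact Ideal.mul_mem_right _ _ (coe_mem_pow_of_mem_comap_pow I ha)
  · rw [Submodule.coe_add, map_add, Finsupp.add_apply]
    exact add_mem hy hz

theorem diag_mem_smul_top {C : Type*} [CommRing C] [Algebra k C] [MulSemiringAction G C]
    [SMulCommClass G k C] {J : Ideal C} [IsStableIdeal G J] (g : G) {x : TwistedTensor C ρ}
    (hx : x ∈ J • (⊤ : Submodule C (TwistedTensor C ρ))) :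
    diag C ρ g x ∈ J • (⊤ : Submodule C (TwistedTensor C ρ)) := by
  refine Submodule.smul_induction_on hx (fun c hc y _ => ?_) fun y z hy hz => ?_
  · rw [diag_smul]
    exact Submodule.smul_mem_smul (IsStableIdeal.smul_mem g c hc) trivial
  · rw [map_add]
    exact add_mem hy hz

section Comparison

variable [FiniteDimensional k V] [FiniteDimensional k V']

theorem exists_completion_comparison (x : AdicCompletion 𝔞 (invariants B ρ)) :
    ∃ w : TwistedTensor Bc ρ, ∀ (n : ℕ) (z : invariants B ρ),
      AdicCompletion.eval 𝔞 _ n x = Submodule.Quotient.mk z →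
        w - extendScalars Bc ρ (z : TwistedTensor B ρ) ∈
          completionIdeal I n • (⊤ : Submodule Bc (TwistedTensor Bc ρ)) := by
  have hz : ∀ n, ∃ z : invariants B ρ, AdicCompletion.eval 𝔞 _ n x = Submodule.Quotient.mk z :=
    fun n => (Submodule.Quotient.mk_surjective _ _).imp fun _ h => h.symm
  choose z hz using hz
  have hsub : ∀ n (y y' : invariants B ρ), AdicCompletion.eval 𝔞 _ n x = Submodule.Quotient.mk y →
      AdicCompletion.eval 𝔞 _ n x = Submodule.Quotient.mk y' → ∀ i,
        (basis B ρ).repr (y : TwistedTensor B ρ) i - (basis B ρ).repr (y' : TwistedTensor B ρ) i ∈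
          I ^ n := by
    intro n y y' h h' i
    rw [h] at h'
    have := repr_mem_pow_of_mem_smul_top I ((Submodule.Quotient.eq _).mp h') i
    rwa [Submodule.coe_sub, map_sub, Finsupp.sub_apply] at this
  have hle : ∀ {m n : ℕ}, m ≤ n → AdicCompletion.eval 𝔞 _ m x = Submodule.Quotient.mk (z n) := by
    intro m n hmn
    have h := LinearMap.congr_fun (AdicCompletion.transitionMap_comp_eval 𝔞 (invariants B ρ) hmn) x
    rw [← h, LinearMap.comp_apply, hz n]
    rfl
  let c : ∀ i : Module.Basis.ofVectorSpaceIndex k V, AdicCompletion.AdicCauchySequence I B :=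
    fun i => ⟨fun n => (basis B ρ).repr (z n : TwistedTensor B ρ) i, fun {m n} hmn => by
      rw [SModEq.sub_mem, smul_eq_mul, Ideal.mul_top]
      exact hsub m _ _ (hz m) (hle hmn) i⟩
  refine ⟨∑ i, AdicCompletion.mk I B (c i) • basis Bc ρ i, fun n y hy => ?_⟩
  rw [← (basis Bc ρ).sum_repr (extendScalars Bc ρ (y : TwistedTensor B ρ)), ← Finset.sum_sub_distrib]
  refine sum_mem fun i _ => ?_
  rw [← sub_smul]
  refine Submodule.smul_mem_smul ?_ trivial
  rw [repr_extendScalars, mem_completionIdeal, map_sub, AdicCompletion.evalₐ_mk,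
    AdicCompletion.algebraMap_apply, AdicCompletion.evalₐ_of, ← map_sub,
    Ideal.Quotient.eq_zero_iff_mem]
  exact hsub n _ _ (hz n) hy i

theorem eq_of_sub_mem {w w' : TwistedTensor Bc ρ} (h : ∀ n, w - w' ∈
    completionIdeal I n • (⊤ : Submodule Bc (TwistedTensor Bc ρ))) : w = w' :=
  sub_eq_zero.mp (eq_zero_of_forall_mem_smul_top _ (iInf_completionIdeal I) h)

variable (ρ) in
/-- The canonical map from the completion of `(B ⊗ V)^G` to the tensor product of `V` with the
completion of `B`. -/
noncomputable def completionComparison :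
    AdicCompletion 𝔞 (invariants B ρ) →+ TwistedTensor Bc ρ :=
  AddMonoidHom.mk' (fun x => (exists_completion_comparison I x).choose) fun x y => by
    refine eq_of_sub_mem I fun n => ?_
    obtain ⟨z, hz⟩ := Submodule.Quotient.mk_surjective _ (AdicCompletion.eval 𝔞 _ n x)
    obtain ⟨z', hz'⟩ := Submodule.Quotient.mk_surjective _ (AdicCompletion.eval 𝔞 _ n y)
    have h := (exists_completion_comparison I (x + y)).choose_spec n (z + z')
      (by rw [map_add, ← hz, ← hz', Submodule.Quotient.mk_add])
    have h1 := (exists_completion_comparison I x).choose_spec n z hz.symm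
    have h2 := (exists_completion_comparison I y).choose_spec n z' hz'.symm
    convert sub_mem h (add_mem h1 h2) using 1
    rw [Submodule.coe_add, map_add]
    abel

theorem completionComparison_spec (x : AdicCompletion 𝔞 (invariants B ρ)) (n : ℕ)
    (z : invariants B ρ) (hz : AdicCompletion.eval 𝔞 _ n x = Submodule.Quotient.mk z) :
    completionComparison ρ I x - extendScalars Bc ρ (z : TwistedTensor B ρ) ∈
      completionIdeal I n • (⊤ : Submodule Bc (TwistedTensor Bc ρ)) :=
  (exists_completion_comparison I x).choose_spec n z hz

theorem completionComparison_of (z : invariants B ρ) :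
    completionComparison ρ I (AdicCompletion.of 𝔞 _ z) =
      extendScalars Bc ρ (z : TwistedTensor B ρ) :=
  eq_of_sub_mem I fun n => completionComparison_spec I _ n z rfl

theorem completionComparison_smul (a : 𝔸) (x : AdicCompletion 𝔞 (invariants B ρ)) :
    completionComparison ρ I (a • x) = algebraMap B Bc a • completionComparison ρ I x := by
  refine eq_of_sub_mem I fun n => ?_
  obtain ⟨z, hz⟩ := Submodule.Quotient.mk_surjective _ (AdicCompletion.eval 𝔞 _ n x)
  have h := completionComparison_spec I (a • x) n (a • z) (by
    rw [map_smul, ← hz, Submodule.Quotient.mk_smul])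
  have h1 := completionComparison_spec I x n z hz.symm
  convert sub_mem h (Submodule.smul_mem _ (algebraMap B Bc a) h1) using 1
  have h2 : ((a • z : invariants B ρ) : TwistedTensor B ρ) = (a : B) • (z : TwistedTensor B ρ) := rfl
  rw [h2, extendScalars_smul, smul_sub]
  abel

theorem diag_completionComparison (g : G) (x : AdicCompletion 𝔞 (invariants B ρ)) :
    diag Bc ρ g (completionComparison ρ I x) = completionComparison ρ I x := by
  refine eq_of_sub_mem I fun n => ?_
  obtain ⟨z, hz⟩ := Submodule.Quotient.mk_surjective _ (AdicCompletion.eval 𝔞 _ n x)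
  have h := completionComparison_spec I x n z hz.symm
  convert sub_mem (diag_mem_smul_top g h) h using 1
  rw [map_sub, ← extendScalars_diag smul_algebraMap_completion, z.2 g]
  abel

theorem smul_mem_pow_smul_top {n : ℕ} {b : B} (hb : b ∈ (𝔞 ^ n).map (algebraMap 𝔸 B))
    (y : TwistedTensor B ρ) : b • y ∈ 𝔞 ^ n • (⊤ : Submodule 𝔸 (TwistedTensor B ρ)) := by
  induction hb using Submodule.span_induction generalizing y with
  | mem b hb =>
    obtain ⟨a, ha, rfl⟩ := hb
    exact Submodule.smul_mem_smul ha trivial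
  | zero => simp
  | add b b' _ _ h h' =>
    rw [add_smul]
    exact add_mem (h y) (h' y)
  | smul c b _ h =>
    rw [smul_eq_mul, mul_comm, mul_smul]
    exact h (c • y)

theorem completionComparison_injective [Finite G] [Algebra.FiniteType k B] :
    Function.Injective (completionComparison ρ I) := by
  have := Algebra.FiniteType.isNoetherianRing k B
  have := isNoetherianRing_fixedPoints (k := k) (B := B) (G := G)
  have := finite_over_fixedPoints (k := k) (B := B) (G := G)
  have : Module.Finite B (TwistedTensor B ρ) := Module.Finite.of_basis (basis B ρ)
  have : IsScalarTower 𝔸 B (TwistedTensor B ρ) := ⟨fun a b x => mul_smul (a : B) b x⟩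
  have : Module.Finite 𝔸 (TwistedTensor B ρ) := Module.Finite.trans B _
  obtain ⟨N, hN⟩ := exists_pow_le_map_comap_fixedPoints (k := k) (G := G) I
  obtain ⟨m, hm⟩ := Ideal.exists_pow_inf_eq_pow_smul 𝔞 (invariants B ρ)
  rw [injective_iff_map_eq_zero]
  intro x hx
  refine AdicCompletion.ext fun n => ?_
  obtain ⟨z, hz⟩ := Submodule.Quotient.mk_surjective _ (AdicCompletion.eval 𝔞 _ (N * (n + m) + n) x)
  have h1 := completionComparison_spec I x _ z hz.symm
  rw [hx, zero_sub, neg_mem_iff] at h1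
  have h2 : (z : TwistedTensor B ρ) ∈ 𝔞 ^ (n + m) • (⊤ : Submodule 𝔸 (TwistedTensor B ρ)) := by
    rw [← (basis B ρ).sum_repr (z : TwistedTensor B ρ)]
    refine sum_mem fun i _ => smul_mem_pow_smul_top I ?_ _
    have h3 := repr_mem_of_mem_smul_top h1 i
    rw [repr_extendScalars, algebraMap_mem_completionIdeal] at h3
    have h4 := Ideal.pow_le_pow_right (Nat.le_add_right (N * (n + m)) n) h3
    rw [pow_mul] at h4
    have h5 := Ideal.pow_right_mono hN (n + m) h4
    rwa [← Ideal.map_pow] at h5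
  have h3 : (z : TwistedTensor B ρ) ∈ 𝔞 ^ n • (invariants B ρ) := by
    have h4 : (z : TwistedTensor B ρ) ∈
        𝔞 ^ (n + m) • (⊤ : Submodule 𝔸 (TwistedTensor B ρ)) ⊓ invariants B ρ := ⟨h2, z.2⟩
    rw [hm (n + m) (Nat.le_add_left m n), Nat.add_sub_cancel] at h4
    exact Submodule.smul_mono le_rfl inf_le_right h4
  have h4 : z ∈ 𝔞 ^ n • (⊤ : Submodule 𝔸 (invariants B ρ)) := by
    have h6 := Submodule.map_smul'' (𝔞 ^ n) (⊤ : Submodule 𝔸 (invariants B ρ)) (invariants B ρ).subtype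
    rw [Submodule.map_subtype_top] at h6
    rw [← h6] at h3
    obtain ⟨z', hz', h5⟩ := h3
    rwa [← Subtype.ext h5]
  have h5 := LinearMap.congr_fun (AdicCompletion.transitionMap_comp_eval 𝔞 (invariants B ρ)
    (Nat.le_add_left n (N * (n + m)))) x
  change AdicCompletion.eval 𝔞 _ n x = 0
  rw [← h5, LinearMap.comp_apply, ← hz]
  exact (Submodule.Quotient.mk_eq_zero _).mpr h4

theorem map_mem_smul_top {C : Type*} [CommRing C] [Algebra k C] [MulSemiringAction G C]
    [SMulCommClass G k C] {J : Ideal C}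
    (ψ : TwistedTensor C ρ →ₗ[SkewMonoidAlgebra C G] TwistedTensor C ρ') {c : C} (hc : c ∈ J)
    (y : TwistedTensor C ρ) : ψ (c • y) ∈ J • (⊤ : Submodule C (TwistedTensor C ρ')) := by
  rw [map_smul_of_linear]
  exact Submodule.smul_mem_smul hc trivial

/-- Maps over the completed ring of invariants are continuous. -/
theorem sub_mem_of_mem_pow_smul_top
    (f : AdicCompletion 𝔞 (invariants B ρ) →ₗ[AdicCompletion 𝔞 𝔸]
      AdicCompletion 𝔞 (invariants B ρ'))
    (ψ : TwistedTensor Bc ρ →ₗ[SkewMonoidAlgebra Bc G] TwistedTensor Bc ρ') {n : ℕ}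
    {y : AdicCompletion 𝔞 (invariants B ρ)}
    (hy : y ∈ 𝔞 ^ n • (⊤ : Submodule 𝔸 (AdicCompletion 𝔞 (invariants B ρ)))) :
    ψ (completionComparison ρ I y) - completionComparison ρ' I (f y) ∈
      completionIdeal I n • (⊤ : Submodule Bc (TwistedTensor Bc ρ')) := by
  refine Submodule.smul_induction_on hy (fun a ha w _ => ?_) fun y z hy hz => ?_
  · have ha' := algebraMap_mem_completionIdeal.mpr (coe_mem_pow_of_mem_comap_pow I ha)
    rw [AdicCompletion.map_smul_of_linear, completionComparison_smul, completionComparison_smul]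
    exact sub_mem (map_mem_smul_top ψ ha' _) (Submodule.smul_mem_smul ha' trivial)
  · rw [map_add, map_add, map_add, map_add, add_sub_add_comm]
    exact add_mem hy hz

theorem completionComparison_eq_of_eqOn [Finite G] [Algebra.FiniteType k B]
    (f : AdicCompletion 𝔞 (invariants B ρ) →ₗ[AdicCompletion 𝔞 𝔸]
      AdicCompletion 𝔞 (invariants B ρ'))
    (ψ : TwistedTensor Bc ρ →ₗ[SkewMonoidAlgebra Bc G] TwistedTensor Bc ρ')
    (hψ : ∀ z : invariants B ρ, ψ (extendScalars Bc ρ (z : TwistedTensor B ρ)) =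
      completionComparison ρ' I (f (AdicCompletion.of 𝔞 _ z)))
    (x : AdicCompletion 𝔞 (invariants B ρ)) :
    ψ (completionComparison ρ I x) = completionComparison ρ' I (f x) := by
  have := isNoetherianRing_fixedPoints (k := k) (B := B) (G := G)
  refine eq_of_sub_mem I fun n => ?_
  obtain ⟨z, hz⟩ := Submodule.Quotient.mk_surjective _ (AdicCompletion.eval 𝔞 _ n x)
  have h := sub_mem_of_mem_pow_smul_top I f ψ
    (AdicCompletion.sub_of_mem_pow_smul_top (IsNoetherian.noetherian 𝔞) hz.symm)
  rwa [map_sub, map_sub, map_sub, map_sub, completionComparison_of, hψ,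
    sub_sub_sub_cancel_right] at h

theorem existsUnique_completion_extension [Finite G] [Algebra.FiniteType k B]
    [IsDomain B] [DecompositionMonoid B] {s t : B} (hs : s ∈ freenessIdeal G B)
    (ht : t ∈ freenessIdeal G B) (hs0 : s ≠ 0) (hst : IsRelPrime s t)
    (f : AdicCompletion 𝔞 (invariants B ρ) →ₗ[AdicCompletion 𝔞 𝔸]
      AdicCompletion 𝔞 (invariants B ρ')) :
    ∃! ψ : TwistedTensor Bc ρ →ₗ[SkewMonoidAlgebra Bc G] TwistedTensor Bc ρ',
      ∀ x, ψ (completionComparison ρ I x) = completionComparison ρ' I (f x) := by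
  have := Algebra.FiniteType.isNoetherianRing k B
  obtain ⟨ψ, hψ, huniq⟩ := existsUnique_extension (C := Bc) (ρ := ρ) (ρ' := ρ') hs ht
    (eq_zero_of_algebraMap_mul_eq_zero hs0 hst) (dvd_of_algebraMap_mul_eq_mul hs0 hst)
    smul_algebraMap_completion
    (fun z => completionComparison ρ' I (f (AdicCompletion.of 𝔞 _ z)))
    (fun x y => by rw [map_add, map_add, map_add])
    (fun a x => by rw [map_smul, AdicCompletion.map_smul_of_linear, completionComparison_smul])
    (fun x g => diag_completionComparison I g _)
  refine ⟨ψ, completionComparison_eq_of_eqOn I f ψ hψ, fun ψ' hψ' => huniq ψ' fun z => ?_⟩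
  rw [← completionComparison_of, hψ']

end Comparison

end TwistedTensor

theorem IsIndecomposableModule.of_ringHom_range {Q W S D T N : Type*} [Ring Q] [AddCommGroup W]
    [Module Q W] [Ring S] [AddCommGroup D] [Module S D] [Ring T] [AddCommGroup N] [Module T N]
    (R : Module.End Q W →+* Module.End T N) (hR : Function.Injective R)
    (P : Module.End S D →+* Module.End T N) (hP : Function.Injective P)
    (hRP : ∀ f, ∃ f', P f' = R f) (h : IsIndecomposableModule S D) : IsIndecomposableModule Q W := by
  rw [isIndecomposableModule_iff_end] at h ⊢
  obtain ⟨h1, h2⟩ := h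
  have : Nontrivial (Module.End T N) := by
    by_contra hN
    rw [not_nontrivial_iff_subsingleton] at hN
    exact one_ne_zero (hP (Subsingleton.elim (P 1) (P 0)))
  refine ⟨R.domain_nontrivial, fun e he => ?_⟩
  obtain ⟨e', he'⟩ := hRP e
  have hid : IsIdempotentElem e' := hP (by rw [map_mul, he']; exact he.map R)
  refine (h2 e' hid).imp (fun h0 => hR ?_) fun h0 => hR ?_
  · rw [← he', h0, map_zero, map_zero]
  · rw [← he', h0, map_one, map_one]

namespace TwistedTensor

variable {k G V V' B : Type*} [Field k] [Group G] [Finite G] [AddCommGroup V] [Module k V]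
  [FiniteDimensional k V] [AddCommGroup V'] [Module k V'] [FiniteDimensional k V']
  [CommRing B] [IsDomain B] [DecompositionMonoid B] [Algebra k B]
  [MulSemiringAction G B] [SMulCommClass G k B]
  {ρ : Representation k G V} {ρ' : Representation k G V'}
  {s t : B} (hs : s ∈ freenessIdeal G B) (ht : t ∈ freenessIdeal G B) (hs0 : s ≠ 0)
  (hst : IsRelPrime s t)

variable (B ρ) in
/-- The inclusion of `(B ⊗ V)^G` in `B ⊗ V`. -/
def invariantsInclusion : invariants B ρ →+ TwistedTensor B ρ := (invariants B ρ).subtype.toAddMonoidHom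

theorem invariantsInclusion_injective : Function.Injective (invariantsInclusion B ρ) :=
  Subtype.val_injective

include hs ht hs0 hst in
theorem existsUnique_invariants_extension
    (f : invariants B ρ →ₗ[FixedPoints.subalgebra k B G] invariants B ρ') :
    ∃! ψ : TwistedTensor B ρ →ₗ[SkewMonoidAlgebra B G] TwistedTensor B ρ',
      ∀ x, ψ (invariantsInclusion B ρ x) = invariantsInclusion B ρ' (f x) := by
  obtain ⟨ψ, hψ, huniq⟩ := existsUnique_extension (C := B) (ρ := ρ) (ρ' := ρ') hs ht
    (eq_zero_of_algebraMap_mul_eq_zero hs0 hst) (dvd_of_algebraMap_mul_eq_mul hs0 hst)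
    (fun _ _ => rfl) (fun z => (f z : TwistedTensor B ρ'))
    (fun x y => by rw [map_add, Submodule.coe_add])
    (fun a x => by rw [map_smul]; rfl)
    (fun x g => (f x).2 g)
  refine ⟨ψ, fun x => ?_, fun ψ' hψ' => huniq ψ' fun z => ?_⟩
  · have h := hψ x
    rwa [extendScalars_self] at h
  · rw [extendScalars_self]
    exact hψ' z

theorem map_extendScalars_of_map_inclHom {C : Type*} [CommRing C] [Algebra k C]
    [MulSemiringAction G C] [SMulCommClass G k C] [Algebra B C] [IsScalarTower k B C]
    (f : ρ.asModule →ₗ[MonoidAlgebra k G] ρ'.asModule)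
    (ψ : TwistedTensor C ρ →ₗ[SkewMonoidAlgebra C G] TwistedTensor C ρ')
    (hψ : ∀ v, ψ (inclHom C ρ v) = inclHom C ρ' (f v)) (x : TwistedTensor B ρ) :
    ψ (extendScalars C ρ x) = extendScalars C ρ'
      ((baseChange (Representation.asModuleHomToLinearMap f) : TwistedTensor B ρ →ₗ[B]
        TwistedTensor B ρ') x) := by
  induction x using TwistedTensor.induction_on with
  | h b v =>
    rw [extendScalars_tmul, tmul_eq_smul, map_smul_of_linear, baseChange_tmul, extendScalars_tmul,
      tmul_eq_smul (algebraMap B C b) (Representation.asModuleHomToLinearMap f v)]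
    exact congrArg _ (hψ v)
  | hadd x y hx hy => simp only [map_add, hx, hy]

section Uncompleted

variable (ε : B →ₐ[k] k)

include hs ht hs0 hst ε in
theorem isIndecomposableModule_asModule_of_invariants
    (h : IsIndecomposableModule (FixedPoints.subalgebra k B G) (invariants B ρ)) :
    IsIndecomposableModule (MonoidAlgebra k G) ρ.asModule := by
  refine h.of_ringHom_range
    (Module.End.ringHomOfExistsUnique (inclHom B ρ) existsUnique_of_asModuleHom)
    (Module.End.ringHomOfExistsUnique_injective _ _ (inclHom_injective ε))
    (Module.End.ringHomOfExistsUnique (invariantsInclusion B ρ)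
      (existsUnique_invariants_extension hs ht hs0 hst))
    (Module.End.ringHomOfExistsUnique_injective _ _ invariantsInclusion_injective)
    fun f => ⟨invariantsMap B f, ?_⟩
  refine (existsUnique_invariants_extension hs ht hs0 hst (invariantsMap B f)).unique
    (Module.End.ringHomOfExistsUnique_apply _ _ _) fun x => ?_
  have h := map_extendScalars_of_map_inclHom f _
    (Module.End.ringHomOfExistsUnique_apply (inclHom B ρ) existsUnique_of_asModuleHom f)
    (x : TwistedTensor B ρ)
  rwa [extendScalars_self, extendScalars_self] at h

include hs ht hs0 hst in
theorem isIndecomposableModule_invariants_of_twistedTensor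
    (h : IsIndecomposableModule (SkewMonoidAlgebra B G) (TwistedTensor B ρ)) :
    IsIndecomposableModule (FixedPoints.subalgebra k B G) (invariants B ρ) :=
  h.of_ringHom (Module.End.ringHomOfExistsUnique (invariantsInclusion B ρ)
      (existsUnique_invariants_extension hs ht hs0 hst)) fun _ _ h0 =>
    Module.End.ringHomOfExistsUnique_injective _ _ invariantsInclusion_injective
      (h0.trans (map_zero _).symm)

include hs ht hs0 hst in
theorem nonempty_linearEquiv_of_invariants :
    Nonempty (invariants B ρ ≃ₗ[FixedPoints.subalgebra k B G] invariants B ρ') →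
      Nonempty (TwistedTensor B ρ ≃ₗ[SkewMonoidAlgebra B G] TwistedTensor B ρ') :=
  nonempty_linearEquiv_of_existsUnique (invariantsInclusion B ρ) (invariantsInclusion B ρ')
    (fun f => (existsUnique_invariants_extension hs ht hs0 hst f).exists)
    (fun f => (existsUnique_invariants_extension hs ht hs0 hst f).exists)
    (fun ψ ψ' h => hom_eq_of_eqOn_invariants hs
      (eq_zero_of_algebraMap_mul_eq_zero (C := B) hs0 hst) fun x hx => by
        rw [extendScalars_self]
        exact h ⟨x, hx⟩)
    (fun ψ ψ' h => hom_eq_of_eqOn_invariants hs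
      (eq_zero_of_algebraMap_mul_eq_zero (C := B) hs0 hst) fun x hx => by
        rw [extendScalars_self]
        exact h ⟨x, hx⟩)

end Uncompleted

section Completed

variable [Algebra.FiniteType k B] (I : Ideal B) [IsStableIdeal G I]
  (ε : AdicCompletion I B →ₐ[k] k)

local notation "𝔸" => FixedPoints.subalgebra k B G
local notation "𝔞" => Ideal.comap (algebraMap (FixedPoints.subalgebra k B G) B) I

include hs ht hs0 hst ε in
theorem isIndecomposableModule_asModule_of_completion
    (h : IsIndecomposableModule (AdicCompletion 𝔞 𝔸) (AdicCompletion 𝔞 (invariants B ρ))) :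
    IsIndecomposableModule (MonoidAlgebra k G) ρ.asModule := by
  refine h.of_ringHom_range
    (Module.End.ringHomOfExistsUnique (inclHom (AdicCompletion I B) ρ) existsUnique_of_asModuleHom)
    (Module.End.ringHomOfExistsUnique_injective _ _ (inclHom_injective ε))
    (Module.End.ringHomOfExistsUnique (completionComparison ρ I)
      (existsUnique_completion_extension I hs ht hs0 hst))
    (Module.End.ringHomOfExistsUnique_injective _ _ (completionComparison_injective I))
    fun f => ⟨AdicCompletion.map 𝔞 (invariantsMap B f), ?_⟩
  refine (existsUnique_completion_extension I hs ht hs0 hst _).unique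
    (Module.End.ringHomOfExistsUnique_apply _ _ _)
    (completionComparison_eq_of_eqOn I _ _ fun z => ?_)
  rw [map_extendScalars_of_map_inclHom f _ (Module.End.ringHomOfExistsUnique_apply
    (inclHom (AdicCompletion I B) ρ) existsUnique_of_asModuleHom f), AdicCompletion.map_of,
    completionComparison_of, coe_invariantsMap]

include hs ht hs0 hst in
theorem isIndecomposableModule_completion_of_twistedTensor
    (h : IsIndecomposableModule (SkewMonoidAlgebra (AdicCompletion I B) G)
      (TwistedTensor (AdicCompletion I B) ρ)) :
    IsIndecomposableModule (AdicCompletion 𝔞 𝔸) (AdicCompletion 𝔞 (invariants B ρ)) :=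
  h.of_ringHom (Module.End.ringHomOfExistsUnique (completionComparison ρ I)
      (existsUnique_completion_extension I hs ht hs0 hst)) fun _ _ h0 =>
    Module.End.ringHomOfExistsUnique_injective _ _ (completionComparison_injective I)
      (h0.trans (map_zero _).symm)

include hs ht hs0 hst in
theorem nonempty_linearEquiv_of_completion :
    Nonempty (AdicCompletion 𝔞 (invariants B ρ) ≃ₗ[AdicCompletion 𝔞 𝔸]
        AdicCompletion 𝔞 (invariants B ρ')) →
      Nonempty (TwistedTensor (AdicCompletion I B) ρ ≃ₗ[SkewMonoidAlgebra (AdicCompletion I B) G]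
        TwistedTensor (AdicCompletion I B) ρ') :=
  have := Algebra.FiniteType.isNoetherianRing k B
  nonempty_linearEquiv_of_existsUnique (completionComparison ρ I) (completionComparison ρ' I)
    (fun f => (existsUnique_completion_extension I hs ht hs0 hst f).exists)
    (fun f => (existsUnique_completion_extension I hs ht hs0 hst f).exists)
    (fun ψ ψ' h => hom_eq_of_eqOn_invariants hs
      (eq_zero_of_algebraMap_mul_eq_zero hs0 hst) fun x hx => by
        have h1 := h (AdicCompletion.of 𝔞 _ ⟨x, hx⟩)
        rwa [completionComparison_of] at h1)
    (fun ψ ψ' h => hom_eq_of_eqOn_invariants hs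
      (eq_zero_of_algebraMap_mul_eq_zero hs0 hst) fun x hx => by
        have h1 := h (AdicCompletion.of 𝔞 _ ⟨x, hx⟩)
        rwa [completionComparison_of] at h1)

end Completed

end TwistedTensor

section GradedPolynomialRing

variable {k B : Type*} [Field k] [CommRing B] [Algebra k B] {𝒜 : ℕ → Submodule k B}

theorem IsGradedPolynomialRing.nonempty_algEquiv (hB : IsGradedPolynomialRing 𝒜) :
    ∃ r : ℕ, Nonempty (MvPolynomial (Fin r) k ≃ₐ[k] B) := by
  obtain ⟨r, d, x, -, hx, htop⟩ := hB
  exact ⟨r, ⟨hx.aevalEquiv.trans ((Subalgebra.equivOfEq _ _ htop).trans Subalgebra.topEquiv)⟩⟩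

theorem irrelevantIdeal_ne_top [GradedAlgebra 𝒜] [Nontrivial B] : irrelevantIdeal 𝒜 ≠ ⊤ := by
  rw [Ideal.ne_top_iff_one]
  intro h
  have h0 : GradedRing.proj 𝒜 0 1 = 0 := h
  rw [GradedRing.proj_apply, DirectSum.decompose_of_mem_same 𝒜 SetLike.GradedOne.one_mem] at h0
  exact one_ne_zero h0

theorem IsGradedPolynomialRing.exists_sub_mem_irrelevantIdeal [GradedAlgebra 𝒜]
    (hB : IsGradedPolynomialRing 𝒜) (b : B) : ∃ c : k, b - algebraMap k B c ∈ irrelevantIdeal 𝒜 := by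
  obtain ⟨r, d, x, hd, -, htop⟩ := hB
  have hb : b ∈ Algebra.adjoin k (Set.range x) := htop ▸ trivial
  induction hb using Algebra.adjoin_induction with
  | mem b hb =>
    obtain ⟨i, rfl⟩ := hb
    refine ⟨0, ?_⟩
    rw [map_zero, sub_zero]
    exact HomogeneousIdeal.mem_irrelevant_of_mem 𝒜 (hd i).1 (hd i).2
  | algebraMap c => exact ⟨c, by rw [sub_self]; exact zero_mem _⟩
  | add b b' _ _ h h' =>
    obtain ⟨c, hc⟩ := h
    obtain ⟨c', hc'⟩ := h'
    refine ⟨c + c', ?_⟩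
    rw [map_add, add_sub_add_comm]
    exact add_mem hc hc'
  | mul b b' _ _ h h' =>
    obtain ⟨c, hc⟩ := h
    obtain ⟨c', hc'⟩ := h'
    refine ⟨c * c', ?_⟩
    have h2 : b * b' - algebraMap k B (c * c') =
        (b - algebraMap k B c) * b' + algebraMap k B c * (b' - algebraMap k B c') := by
      rw [map_mul]
      ring
    rw [h2]
    exact add_mem (Ideal.mul_mem_right _ _ hc) (Ideal.mul_mem_left _ _ hc')

end GradedPolynomialRing

theorem mainTheorem9 {k : Type*} [Field k] {B : Type*} [CommRing B] [Algebra k B]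
    (𝒜 : ℕ → Submodule k B) [GradedAlgebra 𝒜] (hB : IsGradedPolynomialRing 𝒜)
    {G : Type*} [Group G] [Finite G] [MulSemiringAction G B] [SMulCommClass G k B]
    [FaithfulSMul G B] [IsGradedAction 𝒜 G] (hsmall : IsSmallAction G B) :
    (∀ {V : Type*} [AddCommGroup V] [Module k V] [FiniteDimensional k V]
      (ρ : Representation k G V),
      List.TFAE [
        IsIndecomposableModule (MonoidAlgebra k G) ρ.asModule,
        IsIndecomposableModule (SkewMonoidAlgebra B G) (TwistedTensor B ρ),
        IsIndecomposableModule
          (SkewMonoidAlgebra (AdicCompletion (irrelevantIdeal 𝒜) B) G)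
          (TwistedTensor (AdicCompletion (irrelevantIdeal 𝒜) B) ρ),
        IsIndecomposableModule (FixedPoints.subalgebra k B G) (TwistedTensor.invariants B ρ),
        IsIndecomposableModule
          (AdicCompletion (invariantIrrelevantIdeal 𝒜 G) (FixedPoints.subalgebra k B G))
          (AdicCompletion (invariantIrrelevantIdeal 𝒜 G) (TwistedTensor.invariants B ρ))]) ∧
    (∀ {V V' : Type*} [AddCommGroup V] [Module k V] [FiniteDimensional k V]
      [AddCommGroup V'] [Module k V'] [FiniteDimensional k V']
      (ρ : Representation k G V) (ρ' : Representation k G V'),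
      List.TFAE [
        Nonempty (ρ.asModule ≃ₗ[MonoidAlgebra k G] ρ'.asModule),
        Nonempty (TwistedTensor B ρ ≃ₗ[SkewMonoidAlgebra B G] TwistedTensor B ρ'),
        Nonempty
          (TwistedTensor (AdicCompletion (irrelevantIdeal 𝒜) B) ρ
            ≃ₗ[SkewMonoidAlgebra (AdicCompletion (irrelevantIdeal 𝒜) B) G]
              TwistedTensor (AdicCompletion (irrelevantIdeal 𝒜) B) ρ'),
        Nonempty (TwistedTensor.invariants B ρ
          ≃ₗ[FixedPoints.subalgebra k B G] TwistedTensor.invariants B ρ'),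
        Nonempty
          (AdicCompletion (invariantIrrelevantIdeal 𝒜 G) (TwistedTensor.invariants B ρ)
            ≃ₗ[AdicCompletion (invariantIrrelevantIdeal 𝒜 G) (FixedPoints.subalgebra k B G)]
              AdicCompletion (invariantIrrelevantIdeal 𝒜 G)
                (TwistedTensor.invariants B ρ'))]) := by
  obtain ⟨r, ⟨e⟩⟩ := hB.nonempty_algEquiv
  have : IsDomain B := e.symm.toMulEquiv.isDomain
  have : UniqueFactorizationMonoid B := e.toMulEquiv.uniqueFactorizationMonoid inferInstance
  have : Algebra.FiniteType k B := .equiv inferInstance e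
  have : IsNoetherianRing B := Algebra.FiniteType.isNoetherianRing k B
  obtain ⟨s, hs, t, ht, hs0, hst⟩ := exists_isRelPrime_mem_freenessIdeal hsmall
  have htop : irrelevantIdeal 𝒜 ≠ ⊤ := irrelevantIdeal_ne_top
  obtain ⟨ε, hker, hε⟩ := exists_augmentation (k := k) G (irrelevantIdeal 𝒜) htop
    hB.exists_sub_mem_irrelevantIdeal
  have hsep : ⨅ n : ℕ, RingHom.ker ε ^ n = ⊥ := by
    rw [hker]
    exact Ideal.iInf_pow_eq_bot_of_isDomain _ htop
  obtain ⟨ε', hsep', hε'⟩ := exists_augmentation_completion (k := k) G htop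
    hB.exists_sub_mem_irrelevantIdeal
  constructor
  · intro V _ _ _ ρ
    tfae_have 1 ↔ 2 := TwistedTensor.isIndecomposableModule_iff_asModule ε hε hsep
    tfae_have 1 ↔ 3 := TwistedTensor.isIndecomposableModule_iff_asModule ε' hε' hsep'
    tfae_have 2 → 4 :=
      TwistedTensor.isIndecomposableModule_invariants_of_twistedTensor hs ht hs0 hst
    tfae_have 4 → 1 :=
      TwistedTensor.isIndecomposableModule_asModule_of_invariants hs ht hs0 hst ε
    tfae_have 3 → 5 :=
      TwistedTensor.isIndecomposableModule_completion_of_twistedTensor hs ht hs0 hst _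
    tfae_have 5 → 1 :=
      TwistedTensor.isIndecomposableModule_asModule_of_completion hs ht hs0 hst _ ε'
    tfae_finish
  · intro V V' _ _ _ _ _ _ ρ ρ'
    tfae_have 1 ↔ 2 := TwistedTensor.nonempty_linearEquiv_iff_asModule ε hε
    tfae_have 1 ↔ 3 := TwistedTensor.nonempty_linearEquiv_iff_asModule ε' hε'
    tfae_have 1 → 4 := fun ⟨f⟩ => ⟨TwistedTensor.invariantsCongr B f⟩
    tfae_have 4 → 2 := TwistedTensor.nonempty_linearEquiv_of_invariants hs ht hs0 hst
    tfae_have 1 → 5 := fun ⟨f⟩ => ⟨AdicCompletion.congr _ (TwistedTensor.invariantsCongr B f)⟩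
    tfae_have 5 → 3 := TwistedTensor.nonempty_linearEquiv_of_completion hs ht hs0 hst _
    tfae_finish
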